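/- **Setting.** Fix an integer $N\ge 1$ and $r>0$. Let $B_r(w)$ be the open ball in $\mathbb{R}^N$, $B_r=B_r(0)$, $C_r=\overline{B_r}\times\overline{B_r}$, and let $\mathcal M^+(C_r)$ be the set of positive Radon measures on $C_r$. For $A\subset\mathbb{R}^N$ write $\operatorname{osc}_A f=\operatorname{ess\,sup}_A f-\operatorname{ess\,inf}_A f$, and $(A)_\delta=\bigcup_{x\in A}B_\delta(x)$, so that $(\emptyset)_\delta=\emptyset$. For $0\le T\le+\infty$, let $L^\infty_{\mathbf w}(\mathbb{R}^N\times(0,T);\mathcal M^+(C_r))$ be the set of maps $(w,t)\mapsto z_{(w,t)}\in\mathcal M^+(C_r)$ such that $(w,t)\mapsto\int_{C_r}f\,dz_{(w,t)}$ is Lebesgue measurable for every $f\in C^0(C_r)$ and $(w,t)\mapsto z_{(w,t)}(C_r)$ is essentially bounded. For such $z$, the nonlocal divergence $\mathfrak{Div}^r z$ is the signed Radon measure on $\mathbb{R}^N\times(0,T)$ with $$\int\varphi\,d(\mathfrak{Div}^r z)=-\frac1{2r}\int_0^T\!\!\int_{\mathbb{R}^N}\int_{C_r}\big(\varphi(w+x,t)-\varphi(w+y,t)\big)\,dz_{(w,t)}(x,y)\,dw\,dt\qquad\forall\,\varphi\in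 C^0_c(\mathbb{R}^N\times(0,T)).$$ **Weak superflow.** Let $E^0\subset\mathbb{R}^N$ be closed with compact boundary. A closed set $E\subset\mathbb{R}^N\times[0,+\infty)$, with slices $E(t)=\{x:(x,t)\in E\}$, is a *weak superflow* (of the Minkowski curvature flow with radius $r$) with initial datum $E^0$ if * (a) $E(0)\subseteq E^0$, and either $E(t)$ is bounded for all $t\ge0$ or $\mathbb{R}^N\setminus E(t)$ is bounded for all $t\ge 0$; * (b) for every $t\ge0$ and $\delta>0$ there is $\tau>0$ such that $E(s)\subset(E(t))_\delta$ for all $s\in(t,t+\tau)$; * (c) $E(s)\to E(t)$ in the Kuratowski sense as $s\nearrow t$, for every $t>0$; that is, for all times $0\le s_n<t$ with $s_n\to t$, every cluster point of a sequence $x_n\in E(s_n)$ lies in $E(t)$, and every point of $E(t)$ is the limit of some sequence $x_n\in E(s_n)$; * (d) with $T^{\rm ext}=\inf\{t>0: E(s)=\emptyset\ \text{for all } s\ge t\}\in[0,+\infty]$ and $d(x,t)=\operatorname{dist}(x,E(t))$ on $\mathbb{R}^N\times(0,T^{\rm ext})$, there is $z\in L^\infty_{\mathbf w}(\mathbb{R}^N\times(0,T^{\rm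 ext});\mathcal M^+(C_r))$ such that * (d1) $d$ is locally integrable in $(\mathbb{R}^N\times(0,T^{\rm ext}))\setminus E$ and $\partial_t d\ge\mathfrak{Div}^r z$ there, in the sense of distributions (equivalently, as measures); * (d2) for a.e. $(w,t)\in\mathbb{R}^N\times(0,T^{\rm ext})$, $z_{(w,t)}(C_r)\le1$ and $\int_{C_r}\big(d(w+x,t)-d(w+y,t)\big)\,dz_{(w,t)}(x,y)=\operatorname{osc}_{B_r(w)}d(\cdot,t)$; * (d3) for every $\ell>0$, the positive part $(\mathfrak{Div}^r z)^+$ of the measure $\mathfrak{Div}^rz$ has, on $\{(w,t)\in\mathbb{R}^N\times(0,T^{\rm ext}):d(w,t)\ge\ell\}$, an $L^\infty$ density with respect to Lebesgue measure. **Level set sub- and supersolutions.** Let $u^0:\mathbb{R}^N\to\mathbb{R}$ be uniformly continuous. A lower semicontinuous $u:\mathbb{R}^N\times[0,+\infty)\to\mathbb{R}$ is a *level set supersolution* with initial datum $u^0$ if $u(\cdot,0)\ge u^0$ and, for a.e. $\lambda\in\mathbb{R}$, the set $\{(x,t):u(x,t)\le\lambda\}$ is a weak superflow with initial datum $\{u^0\le\lambda\}$.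 An upper semicontinuous $u$ is a *level set subsolution* with initial datum $u^0$ if $-u$ is a level set supersolution with initial datum $-u^0$. **Theorem.** Let $u^0,v^0:\mathbb{R}^N\to\mathbb{R}$ be uniformly continuous functions such that $\{u^0\le\lambda\}$ and $\{v^0\le\lambda\}$ have compact boundary for all $\lambda\in\mathbb{R}$. Let $u$ be a level set subsolution with initial datum $u^0$ and $v$ a level set supersolution with initial datum $v^0$. If $u^0\le v^0$ in $\mathbb{R}^N$, then $u\le v$ in $\mathbb{R}^N\times[0,+\infty)$. -/

import Mathlib

open MeasureTheory Filter Topology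
open scoped ContDiff NNReal ENNReal

namespace MinkowskiFlow

noncomputable section

/-- The Euclidean space `ℝ^N`. -/
abbrev Space (N : ℕ) : Type := EuclideanSpace ℝ (Fin N)

/-- The compact set `C_r`, the product of two copies of the closed ball of radius `r` about `0`. -/
abbrev pairBall (N : ℕ) (r : ℝ) : Set (Space N × Space N) :=
  Metric.closedBall 0 r ×ˢ Metric.closedBall 0 r

/-- The essential oscillation `ess sup_A f - ess inf_A f` with respect to Lebesgue measure
(only used for functions that are bounded on the bounded set `A`). -/
def essOsc {N : ℕ} (A : Set (Space N)) (f : Space N → ℝ) : ℝ :=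
  essSup f (volume.restrict A) - essInf f (volume.restrict A)

/-- Space-time sets are subsets of `ℝ^N × ℝ` contained in `{t ≥ 0}`. The slice `E(t)`. -/
def slice {N : ℕ} (E : Set (Space N × ℝ)) (t : ℝ) : Set (Space N) := {x | (x, t) ∈ E}

/-- Kuratowski convergence of a sequence of sets. -/
def KuratowskiTendsto {X : Type*} [TopologicalSpace X] (D : ℕ → Set X) (L : Set X) : Prop :=
  (∀ x : ℕ → X, (∀ n, x n ∈ D n) → ∀ a, MapClusterPt a atTop x → a ∈ L) ∧
  (∀ a ∈ L, ∃ x : ℕ → X, (∀ n, x n ∈ D n) ∧ Tendsto x atTop (𝓝 a))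

/-- The extinction time `inf {t > 0 : E(s) = ∅ for all s ≥ t}`, with values in `[0, +∞]`
(it is `+∞` if there is no such `t`). -/
def extinctionTime {N : ℕ} (E : Set (Space N × ℝ)) : EReal :=
  ⨅ t ∈ {t : ℝ | 0 < t ∧ ∀ s, t ≤ s → slice E s = ∅}, (t : EReal)

/-- The open space-time cylinder `ℝ^N × (0, T)`. -/
def cylinder (N : ℕ) (T : EReal) : Set (Space N × ℝ) := {p | 0 < p.2 ∧ (p.2 : EReal) < T}

/-- The function `d(x, t) = dist(x, E(t))` (only used at times with `E(t)` nonempty). -/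
def timeDist {N : ℕ} (E : Set (Space N × ℝ)) (p : Space N × ℝ) : ℝ :=
  Metric.infDist p.1 (slice E p.2)

/-- `z` belongs to `L^∞_w(ℝ^N × (0,T); M⁺(C_r))`: weakly measurable, with essentially bounded
total mass. Only the values of `z` on the cylinder matter. -/
structure MemLinftyWeak {N : ℕ} {r : ℝ} (T : EReal)
    (z : Space N × ℝ → FiniteMeasure (pairBall N r)) : Prop where
  weakly_measurable : ∀ f : C(pairBall N r, ℝ),
    AEMeasurable (fun p => ∫ q, f q ∂(z p : Measure (pairBall N r)))
      (volume.restrict (cylinder N T))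
  bounded : ∃ M : ℝ≥0, ∀ᵐ p ∂(volume.restrict (cylinder N T)), (z p).mass ≤ M

/-- The nonlocal spatial divergence of `z`, a signed Radon measure on `ℝ^N × (0,T)`, is
`μ⁺ - μ⁻`, where `μ⁺`, `μ⁻` are its positive and negative parts (mutually singular positive Radon
measures on the cylinder). It is determined by its integrals of continuous functions with compact
support in the cylinder. -/
structure IsNonlocalDiv {N : ℕ} {r : ℝ} (T : EReal)
    (z : Space N × ℝ → FiniteMeasure (pairBall N r))
    (μpos μneg : Measure (Space N × ℝ)) : Prop where
  supported_pos : μpos (cylinder N T)ᶜ = 0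
  supported_neg : μneg (cylinder N T)ᶜ = 0
  radon_pos : ∀ K ⊆ cylinder N T, IsCompact K → μpos K < ⊤
  radon_neg : ∀ K ⊆ cylinder N T, IsCompact K → μneg K < ⊤
  singular : μpos.MutuallySingular μneg
  integral_eq : ∀ φ : Space N × ℝ → ℝ, Continuous φ → HasCompactSupport φ →
    tsupport φ ⊆ cylinder N T →
    ∫ p, φ p ∂μpos - ∫ p, φ p ∂μneg =
      -(1 / (2 * r)) * ∫ p in cylinder N T,
        ∫ q, (φ (p.1 + q.1.1, p.2) - φ (p.1 + q.1.2, p.2)) ∂(z p : Measure (pairBall N r))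

/-- `z` is a nonlocal Cahn-Hoffman field for the space-time set `E` on `ℝ^N × (0, T)`. -/
structure IsCahnHoffmanField {N : ℕ} {r : ℝ} (E : Set (Space N × ℝ)) (T : EReal)
    (z : Space N × ℝ → FiniteMeasure (pairBall N r)) : Prop where
  memLinftyWeak : MemLinftyWeak T z
  /-- The distribution `∂ₜ d` makes sense away from `E`. -/
  locallyIntegrable : LocallyIntegrableOn (timeDist E) (cylinder N T \ E) volume
  mass_le_one : ∀ᵐ p ∂(volume.restrict (cylinder N T)), (z p).mass ≤ 1
  calibration : ∀ᵐ p ∂(volume.restrict (cylinder N T)),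
    ∫ q, (timeDist E (p.1 + q.1.1, p.2) - timeDist E (p.1 + q.1.2, p.2))
        ∂(z p : Measure (pairBall N r)) =
      essOsc (Metric.ball p.1 r) (fun x => timeDist E (x, p.2))
  /-- `∂ₜ d ≥ Div z` as measures in `(ℝ^N × (0,T)) \ E`, and for every `ℓ > 0` the positive part
  of `Div z` has, on `{d ≥ ℓ}`, a bounded density with respect to Lebesgue measure. -/
  divergence : ∃ μpos μneg : Measure (Space N × ℝ), IsNonlocalDiv T z μpos μneg ∧
    (∀ φ : Space N × ℝ → ℝ, ContDiff ℝ ∞ φ → HasCompactSupport φ →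
      tsupport φ ⊆ cylinder N T \ E → (∀ p, 0 ≤ φ p) →
      ∫ p, φ p ∂μpos - ∫ p, φ p ∂μneg ≤
        - ∫ p in cylinder N T \ E, timeDist E p * deriv (fun s => φ (p.1, s)) p.2) ∧
    (∀ ℓ : ℝ, 0 < ℓ → ∃ (M : ℝ≥0) (g : Space N × ℝ → ℝ≥0), Measurable g ∧ (∀ p, g p ≤ M) ∧
      μpos.restrict {p ∈ cylinder N T | ℓ ≤ timeDist E p} =
        (volume.restrict {p ∈ cylinder N T | ℓ ≤ timeDist E p}).withDensity (fun p => (g p : ℝ≥0∞)))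

/-- `E` is a weak superflow of the Minkowski curvature flow with radius `r` and initial datum the
closed set with compact boundary `E₀`. -/
structure IsWeakSuperflow {N : ℕ} (r : ℝ) (E₀ : Set (Space N)) (E : Set (Space N × ℝ)) :
    Prop where
  isClosed_init : IsClosed E₀
  isCompact_frontier_init : IsCompact (frontier E₀)
  subset_halfSpace : E ⊆ {p | 0 ≤ p.2}
  isClosed : IsClosed E
  init : slice E 0 ⊆ E₀
  bounded : (∀ t, 0 ≤ t → Bornology.IsBounded (slice E t)) ∨
    (∀ t, 0 ≤ t → Bornology.IsBounded (slice E t)ᶜ)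
  right_control : ∀ t, 0 ≤ t → ∀ δ, 0 < δ → ∃ τ, 0 < τ ∧
    ∀ s ∈ Set.Ioo t (t + τ), slice E s ⊆ Metric.thickening δ (slice E t)
  left_continuous : ∀ t, 0 < t → ∀ s : ℕ → ℝ, (∀ n, 0 ≤ s n ∧ s n < t) →
    Tendsto s atTop (𝓝 t) → KuratowskiTendsto (fun n => slice E (s n)) (slice E t)
  exists_field : ∃ z : Space N × ℝ → FiniteMeasure (pairBall N r),
    IsCahnHoffmanField E (extinctionTime E) z

/-- `u`, considered on `ℝ^N × [0, +∞)`, is a level set supersolution with initial datum `u₀`. -/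
structure IsLevelSetSupersolution {N : ℕ} (r : ℝ) (u₀ : Space N → ℝ) (u : Space N × ℝ → ℝ) :
    Prop where
  lowerSemicontinuous : LowerSemicontinuousOn u {p | 0 ≤ p.2}
  init : ∀ x, u₀ x ≤ u (x, 0)
  superflow : ∀ᵐ c : ℝ, IsWeakSuperflow r {x | u₀ x ≤ c} {p | 0 ≤ p.2 ∧ u p ≤ c}

/-- `u`, considered on `ℝ^N × [0, +∞)`, is a level set subsolution with initial datum `u₀`. -/
def IsLevelSetSubsolution {N : ℕ} (r : ℝ) (u₀ : Space N → ℝ) (u : Space N × ℝ → ℝ) : Prop :=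
  IsLevelSetSupersolution r (fun x => -u₀ x) (fun p => -u p)

end

end MinkowskiFlow

/-! If `u > v` at some point, two levels separated by a gap give weak superflows `E ⊆ {v ≤ a}`-type
and `F ⊆ {-u ≤ b}`-type with `a < -b` which meet at a positive time. Uniform continuity of `u₀` and
`u₀ ≤ v₀` put their initial data at positive distance. Everything therefore rests on
`IsWeakSuperflow.disjoint`: superflows starting at distance `Δ` stay disjoint. This is proved by
showing that the distance of the slices loses at most `m * s` up to time `s`, with a slope `m` that
can be taken as small as desired.

Formally, one tests the inequalities for `d_E` and `d_F` with `θ(t) (D - d_E - d_F)⁺`. The nonlocal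
terms have a favourable sign by a crosswise comparison
(`integral_add_integral_nonpos_of_calibrated`): the calibrating measures live on pairs of a maximum
and a minimum point, and a function decreasing along both distances is smaller at a maximum point of
one than at a minimum point of the other. What remains is `∫ θ' ((D - d_E - d_F)⁺)² / 2 ≥ 0`, and a
cutoff that decreases after the initial layer forces the square to vanish.

Two obstacles shape the proof. The inequalities hold only away from `E` and `F`, which the support
of the test function could touch. Hence each distance is replaced by `bend ε η d`, which lifts the
values below `η`; for short times, being below level `D` then keeps both distances bounded from
below (`lt_of_bend_add_bend_lt`). The factor `bend'` costs at most `ε * η * M` per distance, where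
`M` bounds the positive part of the divergence away from the set, and the drift `m * (t - α)` in
`level` pays for it. As `M` depends on `η` but not on `ε`, the product `ε * η`, and with it `m`, can
be chosen afterwards.

The distances are moreover only integrable in time, so the chain rule is applied to space-time
mollifications (`IsLocalSupersolution.energy_mollify`) and the sign of the nonlocal terms is
recovered in the limit (`IsLocalSupersolution.energy`). The short-time estimate
`exists_forall_le_dist` is then propagated by real induction, with left continuity of the slices
handling limit times. -/

namespace MinkowskiFlow

/-! ### Real induction and the essential oscillation. -/

/-- Induction along a half-line of real numbers. -/
theorem real_induction_Ici {P : ℝ → Prop} {a : ℝ} (h0 : P a)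
    (hleft : ∀ t, a < t → (∀ s, a ≤ s → s < t → P s) → P t)
    (hright : ∀ t, a ≤ t → P t → ∃ τ, 0 < τ ∧ ∀ s ∈ Set.Ioo t (t + τ), P s) :
    ∀ t, a ≤ t → P t := by
  by_contra! hcon
  obtain ⟨b, hab, hb⟩ := hcon
  set S : Set ℝ := {t | a ≤ t ∧ ¬ P t} with hS
  have hne : S.Nonempty := ⟨b, hab, hb⟩
  have hbdd : BddBelow S := ⟨a, fun t ht => ht.1⟩
  set c := sInf S with hc
  have hac : a ≤ c := le_csInf hne fun t ht => ht.1
  have hlt : ∀ s, a ≤ s → s < c → P s := fun s hs hsc => by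
    by_contra h
    exact absurd (csInf_le hbdd (show s ∈ S from ⟨hs, h⟩)) (not_le.2 hsc)
  have hPc : P c := by
    rcases hac.eq_or_lt with h | h
    · rw [← h]; exact h0
    · exact hleft c h hlt
  obtain ⟨τ, hτ, hP⟩ := hright c hac hPc
  obtain ⟨s, hs, hsc⟩ := exists_lt_of_csInf_lt hne (show sInf S < c + τ by linarith)
  have hcs : c ≤ s := csInf_le hbdd hs
  rcases hcs.eq_or_lt with h | h
  · exact hs.2 (h ▸ hPc)
  · exact hs.2 (hP s ⟨h, hsc⟩)

/-- For continuous functions essential bounds are genuine: a violation inside the open ball would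
occupy a nonempty open set, which has positive measure, and the closed ball is reached by density.
-/
theorem sub_le_essOsc {N : ℕ} {f : Space N → ℝ} (hf : Continuous f) {w : Space N} {r : ℝ}
    (hr : 0 < r) {x y : Space N} (hx : x ∈ Metric.closedBall w r)
    (hy : y ∈ Metric.closedBall w r) : f x - f y ≤ essOsc (Metric.ball w r) f := by
  obtain ⟨C, hC⟩ := (isCompact_closedBall w r).exists_bound_of_continuousOn hf.continuousOn
  have hball : ∀ᵐ z ∂(volume.restrict (Metric.ball w r)), ‖f z‖ ≤ C :=
    (ae_restrict_mem measurableSet_ball).mono fun z hz => hC z (Metric.ball_subset_closedBall hz)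
  have hclos : ∀ z ∈ Metric.closedBall w r, z ∈ closure (Metric.ball w r) := fun z hz => by
    rwa [closure_ball w hr.ne']
  have hbu : IsBoundedUnder (· ≤ ·) (ae (volume.restrict (Metric.ball w r))) f :=
    ⟨C, by simpa using hball.mono fun z hz => (abs_le.1 hz).2⟩
  have hbl : IsBoundedUnder (· ≥ ·) (ae (volume.restrict (Metric.ball w r))) f :=
    ⟨-C, by simpa using hball.mono fun z hz => (abs_le.1 hz).1⟩
  have key : ∀ {g : Space N → ℝ}, Continuous g →
      (∀ᵐ z ∂(volume.restrict (Metric.ball w r)), 0 ≤ g z) →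
      ∀ z ∈ Metric.closedBall w r, 0 ≤ g z := by
    intro g hg h z hz
    have hsub : Metric.ball w r ⊆ {z | 0 ≤ g z} := by
      intro u hu
      by_contra hneg
      have hopen : IsOpen (Metric.ball w r ∩ {z | g z < 0}) :=
        Metric.isOpen_ball.inter (isOpen_lt hg continuous_const)
      have hpos := hopen.measure_pos volume ⟨u, hu, by simpa using hneg⟩
      rw [ae_restrict_iff' measurableSet_ball] at h
      refine hpos.ne' (measure_mono_null ?_ (ae_iff.1 h))
      rintro v ⟨hv, hv'⟩
      simp only [Set.mem_ofPred_eq] at hv' ⊢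
      intro h'
      exact absurd (h' hv) (not_le.2 hv')
    exact closure_minimal hsub (isClosed_le continuous_const hg) (hclos z hz)
  have h1 := key (g := fun z => essSup f (volume.restrict (Metric.ball w r)) - f z)
    (continuous_const.sub hf) ((ae_le_essSup hbu).mono fun z hz => sub_nonneg.2 hz) x hx
  have h2 := key (g := fun z => f z - essInf f (volume.restrict (Metric.ball w r)))
    (hf.sub continuous_const) ((ae_essInf_le hbl).mono fun z hz => sub_nonneg.2 hz) y hy
  unfold essOsc
  linarith

/-! ### Monotonicity of calibrating measures. -/

section Calibration

variable {N : ℕ} {r : ℝ}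

theorem continuous_comp_fst {a : Space N → ℝ} (ha : Continuous a) :
    Continuous fun q : pairBall N r => a q.1.1 :=
  ha.comp (continuous_fst.comp continuous_subtype_val)

theorem continuous_comp_snd {a : Space N → ℝ} (ha : Continuous a) :
    Continuous fun q : pairBall N r => a q.1.2 :=
  ha.comp (continuous_snd.comp continuous_subtype_val)

instance compactSpace_pairBall : CompactSpace (pairBall N r) :=
  isCompact_iff_compactSpace.1 ((isCompact_closedBall 0 r).prod (isCompact_closedBall 0 r))

theorem integrable_pairBall {P : Measure (pairBall N r)} [IsFiniteMeasure P]
    {f : pairBall N r → ℝ} (hf : Continuous f) : Integrable f P :=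
  hf.integrable_of_hasCompactSupport (HasCompactSupport.of_compactSpace f)

/-- A calibrating measure can be completed to a probability measure which is concentrated on pairs
of maximum and minimum points. -/
theorem exists_probability_of_calibrated (hr : 0 < r) {P : Measure (pairBall N r)}
    [IsFiniteMeasure P] (hP : P.real Set.univ ≤ 1) {a : Space N → ℝ} (ha : Continuous a) {c : ℝ}
    (hc : ∀ x ∈ Metric.closedBall (0 : Space N) r, ∀ y ∈ Metric.closedBall (0 : Space N) r,
      a x - a y ≤ c) (hcal : ∫ q, (a q.1.1 - a q.1.2) ∂P = c) :
    ∃ P' : Measure (pairBall N r), IsProbabilityMeasure P' ∧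
      (∀ᵐ q ∂P', ∀ x ∈ Metric.closedBall (0 : Space N) r, a x ≤ a q.1.1 ∧ a q.1.2 ≤ a x) ∧
      ∀ f : Space N → ℝ, Continuous f →
        ∫ q, (f q.1.1 - f q.1.2) ∂P' = ∫ q, (f q.1.1 - f q.1.2) ∂P := by
  have h0 : (0 : Space N) ∈ Metric.closedBall (0 : Space N) r := by simp [hr.le]
  have hc0 : 0 ≤ c := by simpa using hc 0 h0 0 h0
  let o : pairBall N r := ⟨(0, 0), h0, h0⟩
  have hint : Integrable (fun q : pairBall N r => a q.1.1 - a q.1.2) P :=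
    integrable_pairBall ((continuous_comp_fst ha).sub (continuous_comp_snd ha))
  have hnn : ∀ q : pairBall N r, 0 ≤ c - (a q.1.1 - a q.1.2) := fun q =>
    sub_nonneg.2 (hc _ q.2.1 _ q.2.2)
  -- The integrand is nonnegative, but its integral is nonpositive because the mass is at most one
  -- and `0 ≤ c`. So it vanishes almost everywhere, that is, `P` sees only extremal pairs.
  have hI : ∫ q, (c - (a q.1.1 - a q.1.2)) ∂P = P.real Set.univ * c - c := by
    rw [integral_sub (integrable_const c) hint, hcal]; simp
  have hI0 : 0 ≤ ∫ q, (c - (a q.1.1 - a q.1.2)) ∂P := integral_nonneg hnn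
  have hmc : P.real Set.univ * c ≤ c := by nlinarith
  have hI1 : ∫ q, (c - (a q.1.1 - a q.1.2)) ∂P = 0 := by rw [hI] at hI0 ⊢; linarith
  have hae := (integral_eq_zero_iff_of_nonneg hnn ((integrable_const c).sub hint)).1 hI1
  -- The missing mass is put on the diagonal point `(0, 0)`, where every difference `f x - f y`
  -- vanishes.
  refine ⟨P + ENNReal.ofReal (1 - P.real Set.univ) • Measure.dirac o, ⟨?_⟩, ?_, ?_⟩
  · rw [Measure.add_apply, Measure.smul_apply, Measure.dirac_apply_of_mem (Set.mem_univ _),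
      smul_eq_mul, mul_one, ← ofReal_measureReal (measure_ne_top P _),
      ← ENNReal.ofReal_add measureReal_nonneg (by linarith)]
    simp
  · rw [ae_add_measure_iff]
    refine ⟨hae.mono fun q hq x hx => ?_, ?_⟩
    · have hq' : c - (a q.1.1 - a q.1.2) = 0 := hq
      have h1 := hc x hx _ q.2.2
      have h2 := hc _ q.2.1 x hx
      constructor <;> linarith
    · rcases eq_or_lt_of_le hP with h | h
      · simp [h]
      -- If mass is missing, the vanishing deficit forces `c = 0`; then `a` is constant on the ball
      -- and every pair is extremal.
      · have hcz : c = 0 := by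
          rw [hI] at hI1
          have : (P.real Set.univ - 1) * c = 0 := by linarith
          rcases mul_eq_zero.1 this with h' | h'
          · linarith
          · exact h'
        refine Eventually.of_forall fun q x hx => ?_
        have h1 := hc x hx _ q.2.1
        have h2 := hc _ q.2.2 x hx
        constructor <;> linarith
  · intro f hf
    have hg : Continuous fun q : pairBall N r => f q.1.1 - f q.1.2 :=
      (continuous_comp_fst hf).sub (continuous_comp_snd hf)
    rw [integral_add_measure (integrable_pairBall hg)]
    · rw [integral_smul_measure, integral_dirac]
      simp [o]
    · exact (integrable_dirac (by simp)).smul_measure ENNReal.ofReal_ne_top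

/-- The monotonicity inequality for two calibrating measures. -/
theorem integral_add_integral_nonpos_of_calibrated (hr : 0 < r) {P Q : Measure (pairBall N r)}
    [IsFiniteMeasure P] [IsFiniteMeasure Q] (hP : P.real Set.univ ≤ 1) (hQ : Q.real Set.univ ≤ 1)
    {a b f : Space N → ℝ} (ha : Continuous a) (hb : Continuous b) (hf : Continuous f) {c d : ℝ}
    (hc : ∀ x ∈ Metric.closedBall (0 : Space N) r, ∀ y ∈ Metric.closedBall (0 : Space N) r,
      a x - a y ≤ c) (hcal : ∫ q, (a q.1.1 - a q.1.2) ∂P = c)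
    (hd : ∀ x ∈ Metric.closedBall (0 : Space N) r, ∀ y ∈ Metric.closedBall (0 : Space N) r,
      b x - b y ≤ d) (hdal : ∫ q, (b q.1.1 - b q.1.2) ∂Q = d)
    (hfab : ∀ x y, a y ≤ a x → b y ≤ b x → f x ≤ f y) :
    ∫ q, (f q.1.1 - f q.1.2) ∂P + ∫ q, (f q.1.1 - f q.1.2) ∂Q ≤ 0 := by
  obtain ⟨P', hP', hPae, hPf⟩ := exists_probability_of_calibrated hr hP ha hc hcal
  obtain ⟨Q', hQ', hQae, hQf⟩ := exists_probability_of_calibrated hr hQ hb hd hdal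
  rw [← hPf f hf, ← hQf f hf]
  have i1 : ∀ (M : Measure (pairBall N r)) [IsProbabilityMeasure M],
      Integrable (fun q : pairBall N r => f q.1.1) M := fun M _ =>
    integrable_pairBall (continuous_comp_fst hf)
  have i2 : ∀ (M : Measure (pairBall N r)) [IsProbabilityMeasure M],
      Integrable (fun q : pairBall N r => f q.1.2) M := fun M _ =>
    integrable_pairBall (continuous_comp_snd hf)
  -- Crosswise pairing: `q.1.1` maximizes `a` and `q'.1.2` minimizes `b`, so both functions are at
  -- least as large at the first point as at the second. Integrating over both variables uses that
  -- the masses are exactly one.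
  have key1 : ∫ q, f q.1.1 ∂P' ≤ ∫ q, f q.1.2 ∂Q' := by
    have : ∀ᵐ q ∂P', f q.1.1 ≤ ∫ q', f q'.1.2 ∂Q' := hPae.mono fun q hq => by
      have h := integral_mono_ae (integrable_const (f q.1.1)) (i2 Q')
        (hQae.mono fun q' hq' => hfab _ _ (hq _ q'.2.2).1 (hq' _ q.2.1).2)
      simpa using h
    simpa using integral_mono_ae (i1 P') (integrable_const _) this
  have key2 : ∫ q, f q.1.1 ∂Q' ≤ ∫ q, f q.1.2 ∂P' := by
    have : ∀ᵐ q ∂Q', f q.1.1 ≤ ∫ q', f q'.1.2 ∂P' := hQae.mono fun q hq => by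
      have h := integral_mono_ae (integrable_const (f q.1.1)) (i2 P')
        (hPae.mono fun q' hq' => hfab _ _ (hq' _ q.2.1).2 (hq _ q'.2.2).1)
      simpa using h
    simpa using integral_mono_ae (i1 Q') (integrable_const _) this
  rw [integral_sub (i1 P') (i2 P'), integral_sub (i1 Q') (i2 Q')]
  linarith

end Calibration

end MinkowskiFlow

/-! ### Calibrating fields and the nonlocal operator `pairDiff`. -/

namespace MinkowskiFlow

/-- Weak measurability concerns a fixed integrand; here the integrand varies with the base point. A
simple `C(X, ℝ)`-valued function reduces to finitely many fixed integrands, and the general case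
follows since uniform convergence passes through finite measures. -/
theorem aemeasurable_integral_finiteMeasure {X V : Type*} [TopologicalSpace X] [CompactSpace X]
    [MeasurableSpace X] [OpensMeasurableSpace X] [MeasurableSpace V] {μ : Measure V}
    {z : V → FiniteMeasure X}
    (hz : ∀ f : C(X, ℝ), AEMeasurable (fun p => ∫ q, f q ∂(z p : Measure X)) μ)
    {H : V → C(X, ℝ)} (hH : StronglyMeasurable H) :
    AEMeasurable (fun p => ∫ q, H p q ∂(z p : Measure X)) μ := by
  have hi : ∀ (p : V) (f : C(X, ℝ)), Integrable f (z p : Measure X) := fun p f =>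
    f.continuous.integrable_of_hasCompactSupport (HasCompactSupport.of_compactSpace _)
  refine aemeasurable_of_tendsto_metrizable_ae atTop
    (f := fun n p => ∫ q, hH.approx n p q ∂(z p : Measure X)) (fun n => ?_)
    (Eventually.of_forall fun p => ?_)
  · have : (fun p => ∫ q, hH.approx n p q ∂(z p : Measure X)) =
        fun p => ∑ c ∈ (hH.approx n).range,
          (hH.approx n ⁻¹' {c}).indicator (fun p => ∫ q, c q ∂(z p : Measure X)) p := by
      funext p
      rw [Finset.sum_eq_single (hH.approx n p)]
      · simp [Set.indicator]
      · intro c _ hc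
        exact Set.indicator_of_notMem (fun h => hc (by simpa using h.symm)) _
      · intro h
        exact absurd (SimpleFunc.mem_range_self _ p) h
    rw [this]
    exact Finset.aemeasurable_fun_sum _ fun c _ =>
      (hz c).indicator ((hH.approx n).measurableSet_preimage _)
  · rw [tendsto_iff_norm_sub_tendsto_zero]
    have h1 : Tendsto (fun n => ‖hH.approx n p - H p‖ * (z p : Measure X).real Set.univ) atTop
        (𝓝 0) := by
      have := (tendsto_iff_norm_sub_tendsto_zero.1 (hH.tendsto_approx p)).mul_const
        ((z p : Measure X).real Set.univ)
      simpa using this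
    refine squeeze_zero (fun _ => norm_nonneg _) (fun n => ?_) h1
    rw [← integral_sub (hi _ _) (hi _ _)]
    refine norm_integral_le_of_norm_le_const (Eventually.of_forall fun q => ?_)
    exact ContinuousMap.norm_coe_le_norm (hH.approx n p - H p) q

/-- The inner integral in the definition of the nonlocal divergence. -/
noncomputable def pairDiff {N : ℕ} {r : ℝ} (z : Space N × ℝ → FiniteMeasure (pairBall N r))
    (φ : Space N × ℝ → ℝ) (p : Space N × ℝ) : ℝ :=
  ∫ q, (φ (p.1 + q.1.1, p.2) - φ (p.1 + q.1.2, p.2)) ∂(z p : Measure (pairBall N r))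

/-- `z` is a calibrating field for `A` on the space-time set `W`. -/
structure IsCalibration {N : ℕ} (r : ℝ) (W : Set (Space N × ℝ)) (A : Space N × ℝ → ℝ)
    (z : Space N × ℝ → FiniteMeasure (pairBall N r)) : Prop where
  lipschitz : ∀ t, LipschitzWith 1 fun x => A (x, t)
  weakly_measurable : ∀ f : C(pairBall N r, ℝ),
    AEMeasurable (fun p => ∫ q, f q ∂(z p : Measure (pairBall N r))) (volume.restrict W)
  mass_le_one : ∀ᵐ p ∂(volume.restrict W), (z p : Measure (pairBall N r)).real Set.univ ≤ 1
  calibration : ∀ᵐ p ∂(volume.restrict W),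
    pairDiff z A p = essOsc (Metric.ball p.1 r) fun x => A (x, p.2)

section PairDiff

variable {N : ℕ} {r : ℝ} {z : Space N × ℝ → FiniteMeasure (pairBall N r)}

theorem continuous_pairDiff_integrand {φ : Space N → ℝ} (hφ : Continuous φ) (w : Space N) :
    Continuous fun q : pairBall N r => φ (w + q.1.1) - φ (w + q.1.2) := by
  fun_prop

theorem integrable_pairDiff_integrand {φ : Space N × ℝ → ℝ} {p : Space N × ℝ}
    (hφ : Continuous fun x => φ (x, p.2)) :
    Integrable (fun q : pairBall N r => φ (p.1 + q.1.1, p.2) - φ (p.1 + q.1.2, p.2))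
      (z p : Measure (pairBall N r)) :=
  integrable_pairBall (continuous_pairDiff_integrand hφ p.1)

theorem aestronglyMeasurable_pairDiff {μ : Measure (Space N × ℝ)}
    (hz : ∀ f : C(pairBall N r, ℝ),
      AEMeasurable (fun p => ∫ q, f q ∂(z p : Measure (pairBall N r))) μ)
    {φ : Space N × ℝ → ℝ} (hφ : Continuous φ) : AEStronglyMeasurable (pairDiff z φ) μ := by
  let H : C(Space N × ℝ, C(pairBall N r, ℝ)) := ContinuousMap.curry
    ⟨fun p : (Space N × ℝ) × pairBall N r =>
      φ (p.1.1 + p.2.1.1, p.1.2) - φ (p.1.1 + p.2.1.2, p.1.2), by fun_prop⟩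
  exact (aemeasurable_integral_finiteMeasure hz
    (H := H) H.continuous.stronglyMeasurable).aestronglyMeasurable

theorem norm_pairDiff_le {φ : Space N × ℝ → ℝ} {C : ℝ} (hC : ∀ p, |φ p| ≤ C) {p : Space N × ℝ}
    (hp : (z p : Measure (pairBall N r)).real Set.univ ≤ 1) : ‖pairDiff z φ p‖ ≤ 2 * C := by
  have hC0 : 0 ≤ C := (abs_nonneg _).trans (hC p)
  refine (norm_integral_le_of_norm_le_const (C := 2 * C) (Eventually.of_forall fun q => ?_)).trans
    (mul_le_of_le_one_right (by linarith) hp)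
  refine (norm_sub_le _ _).trans ?_
  have h1 := hC (p.1 + q.1.1, p.2)
  have h2 := hC (p.1 + q.1.2, p.2)
  rw [Real.norm_eq_abs, Real.norm_eq_abs]
  linarith

theorem pairDiff_eq_zero {φ : Space N × ℝ → ℝ} {R : ℝ} {J : Set ℝ}
    (hφ : ∀ p, φ p ≠ 0 → ‖p.1‖ ≤ R ∧ p.2 ∈ J) {p : Space N × ℝ}
    (hp : ¬ (‖p.1‖ ≤ R + r ∧ p.2 ∈ J)) : pairDiff z φ p = 0 := by
  have h0 : ∀ x : Space N, ‖x‖ ≤ r → φ (p.1 + x, p.2) = 0 := by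
    intro x hx
    by_contra h
    obtain ⟨h1, h2⟩ := hφ _ h
    refine hp ⟨?_, h2⟩
    calc ‖p.1‖ = ‖(p.1 + x) - x‖ := by simp
      _ ≤ ‖p.1 + x‖ + ‖x‖ := norm_sub_le _ _
      _ ≤ R + r := add_le_add h1 hx
  unfold pairDiff
  refine integral_eq_zero_of_ae (Eventually.of_forall fun q => ?_)
  have h1 := h0 q.1.1 (by simpa using q.2.1)
  have h2 := h0 q.1.2 (by simpa using q.2.2)
  simp [h1, h2]

theorem pairDiff_sub_mul {φ ψ : Space N × ℝ → ℝ} (hφ : Continuous φ) (hψ : Continuous ψ) (c : ℝ)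
    (p : Space N × ℝ) :
    pairDiff z (fun p => φ p - c * ψ p) p = pairDiff z φ p - c * pairDiff z ψ p := by
  unfold pairDiff
  rw [← integral_const_mul, ← integral_sub (integrable_pairDiff_integrand (by fun_prop))
    ((integrable_pairDiff_integrand (by fun_prop)).const_mul c)]
  congr 1
  funext q
  ring

theorem isCompact_box (N : ℕ) (R α β : ℝ) :
    IsCompact ({p | ‖p.1‖ ≤ R ∧ p.2 ∈ Set.Icc α β} : Set (Space N × ℝ)) := by
  have : ({p | ‖p.1‖ ≤ R ∧ p.2 ∈ Set.Icc α β} : Set (Space N × ℝ)) =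
      Metric.closedBall 0 R ×ˢ Set.Icc α β := by
    ext p; simp
  rw [this]
  exact (isCompact_closedBall _ _).prod isCompact_Icc

theorem integrable_indicator_box (N : ℕ) (R α β C : ℝ) :
    Integrable (({p | ‖p.1‖ ≤ R ∧ p.2 ∈ Set.Icc α β} : Set (Space N × ℝ)).indicator
      fun _ => C) := by
  rw [integrable_indicator_iff (isCompact_box N R α β).measurableSet]
  exact integrableOn_const (isCompact_box N R α β).measure_lt_top.ne

theorem norm_pairDiff_le_indicator {φ : Space N × ℝ → ℝ} {C R α β : ℝ} (hC : ∀ p, |φ p| ≤ C)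
    (hφ : ∀ p, φ p ≠ 0 → ‖p.1‖ ≤ R ∧ p.2 ∈ Set.Icc α β) {p : Space N × ℝ}
    (hp : (z p : Measure (pairBall N r)).real Set.univ ≤ 1) :
    ‖pairDiff z φ p‖ ≤ ({p | ‖p.1‖ ≤ R + r ∧ p.2 ∈ Set.Icc α β} : Set (Space N × ℝ)).indicator
      (fun _ => 2 * C) p := by
  by_cases h : ‖p.1‖ ≤ R + r ∧ p.2 ∈ Set.Icc α β
  · rw [Set.indicator_of_mem (by exact h)]
    exact norm_pairDiff_le hC hp
  · rw [Set.indicator_of_notMem (by exact h), pairDiff_eq_zero hφ h, norm_zero]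

theorem IsCalibration.integrableOn_pairDiff {W : Set (Space N × ℝ)} {A : Space N × ℝ → ℝ}
    (h : IsCalibration r W A z) {φ : Space N × ℝ → ℝ} (hφc : Continuous φ) {C R α β : ℝ}
    (hC : ∀ p, |φ p| ≤ C) (hφ : ∀ p, φ p ≠ 0 → ‖p.1‖ ≤ R ∧ p.2 ∈ Set.Icc α β) :
    IntegrableOn (pairDiff z φ) W :=
  (integrable_indicator_box N (R + r) α β (2 * C)).restrict.mono'
    (aestronglyMeasurable_pairDiff h.weakly_measurable hφc)
    (h.mass_le_one.mono fun _ hp => norm_pairDiff_le_indicator hC hφ hp)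

/-- Pointwise monotonicity of two calibrations, tested with a function which decreases along both
calibrated functions. -/
theorem IsCalibration.pairDiff_add_pairDiff_nonpos (hr : 0 < r) {W : Set (Space N × ℝ)}
    {A B : Space N × ℝ → ℝ} {y : Space N × ℝ → FiniteMeasure (pairBall N r)}
    (hA : IsCalibration r W A z) (hB : IsCalibration r W B y) {f : Space N × ℝ → ℝ}
    (hf : ∀ t, Continuous fun x => f (x, t))
    (hfAB : ∀ t x x', A (x', t) ≤ A (x, t) → B (x', t) ≤ B (x, t) → f (x, t) ≤ f (x', t)) :
    ∀ᵐ p ∂(volume.restrict W), pairDiff z f p + pairDiff y f p ≤ 0 := by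
  filter_upwards [hA.mass_le_one, hA.calibration, hB.mass_le_one, hB.calibration]
    with p h1 h2 h3 h4
  have hcont : ∀ {g : Space N → ℝ}, Continuous g → Continuous fun x => g (p.1 + x) :=
    fun hg => hg.comp (continuous_const.add continuous_id)
  have hmem : ∀ x ∈ Metric.closedBall (0 : Space N) r, p.1 + x ∈ Metric.closedBall p.1 r := by
    intro x hx
    simpa using hx
  exact integral_add_integral_nonpos_of_calibrated hr h1 h3
    (a := fun x => A (p.1 + x, p.2)) (b := fun x => B (p.1 + x, p.2))
    (f := fun x => f (p.1 + x, p.2))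
    (hcont (hA.lipschitz p.2).continuous) (hcont (hB.lipschitz p.2).continuous) (hcont (hf p.2))
    (fun x hx x' hx' => sub_le_essOsc (hA.lipschitz p.2).continuous hr (hmem x hx) (hmem x' hx'))
    h2
    (fun x hx x' hx' => sub_le_essOsc (hB.lipschitz p.2).continuous hr (hmem x hx) (hmem x' hx'))
    h4 (fun x x' => hfAB p.2 _ _)

theorem tendsto_pairDiff {φ : ℕ → Space N × ℝ → ℝ} {f : Space N × ℝ → ℝ} {C : ℝ}
    (hφc : ∀ n, Continuous (φ n)) (hC : ∀ n p, |φ n p| ≤ C) {p : Space N × ℝ}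
    (hlim : ∀ x, Tendsto (fun n => φ n (x, p.2)) atTop (𝓝 (f (x, p.2)))) :
    Tendsto (fun n => pairDiff z (φ n) p) atTop (𝓝 (pairDiff z f p)) := by
  refine tendsto_integral_of_dominated_convergence (fun _ => 2 * C) (fun n => ?_)
    (integrable_const _) (fun n => Eventually.of_forall fun q => ?_)
    (Eventually.of_forall fun q => (hlim _).sub (hlim _))
  · exact (integrable_pairDiff_integrand (z := z)
      ((hφc n).comp (Continuous.prodMk_left p.2))).aestronglyMeasurable
  · refine (norm_sub_le _ _).trans ?_
    have h1 := hC n (p.1 + q.1.1, p.2)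
    have h2 := hC n (p.1 + q.1.2, p.2)
    rw [Real.norm_eq_abs, Real.norm_eq_abs]
    linarith

/-- Smoothed test functions need not be monotone along `A` and `B`, so only their limit `f` has a
sign. The mass bound and the common box provide the domination needed to pass to it. -/
theorem IsCalibration.exists_tendsto_nonpos (hr : 0 < r) {W : Set (Space N × ℝ)}
    {A B : Space N × ℝ → ℝ} {y : Space N × ℝ → FiniteMeasure (pairBall N r)}
    (hA : IsCalibration r W A z) (hB : IsCalibration r W B y)
    {φ : ℕ → Space N × ℝ → ℝ} {f : Space N × ℝ → ℝ} {C R α β : ℝ}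
    (hφc : ∀ n, Continuous (φ n)) (hC : ∀ n p, |φ n p| ≤ C)
    (hφ : ∀ n p, φ n p ≠ 0 → ‖p.1‖ ≤ R ∧ p.2 ∈ Set.Icc α β)
    (hf : ∀ t, Continuous fun x => f (x, t))
    (hfAB : ∀ t x x', A (x', t) ≤ A (x, t) → B (x', t) ≤ B (x, t) → f (x, t) ≤ f (x', t))
    (hlim : ∀ᵐ p : Space N × ℝ, ∀ x, Tendsto (fun n => φ n (x, p.2)) atTop (𝓝 (f (x, p.2)))) :
    ∃ c ≤ 0, Tendsto (fun n => (∫ p in W, pairDiff z (φ n) p) + ∫ p in W, pairDiff y (φ n) p)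
      atTop (𝓝 c) := by
  have hT : ∀ {A : Space N × ℝ → ℝ} {z : Space N × ℝ → FiniteMeasure (pairBall N r)},
      IsCalibration r W A z → Tendsto (fun n => ∫ p in W, pairDiff z (φ n) p) atTop
        (𝓝 (∫ p in W, pairDiff z f p)) ∧ IntegrableOn (pairDiff z f) W := by
    intro A z hA
    have hae : ∀ᵐ p ∂(volume.restrict W),
        Tendsto (fun n => pairDiff z (φ n) p) atTop (𝓝 (pairDiff z f p)) :=
      (ae_restrict_of_ae hlim).mono fun p hp => tendsto_pairDiff hφc hC hp
    have hm : ∀ n, AEStronglyMeasurable (pairDiff z (φ n)) (volume.restrict W) := fun n =>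
      aestronglyMeasurable_pairDiff hA.weakly_measurable (hφc n)
    have hb : ∀ n, ∀ᵐ p ∂(volume.restrict W), ‖pairDiff z (φ n) p‖ ≤
        ({p | ‖p.1‖ ≤ R + r ∧ p.2 ∈ Set.Icc α β} : Set (Space N × ℝ)).indicator
          (fun _ => 2 * C) p := fun n =>
      hA.mass_le_one.mono fun _ hp => norm_pairDiff_le_indicator (hC n) (hφ n) hp
    have hi := (integrable_indicator_box N (R + r) α β (2 * C)).restrict (s := W)
    refine ⟨tendsto_integral_of_dominated_convergence _ hm hi hb hae, hi.mono'
      (aestronglyMeasurable_of_tendsto_ae atTop hm hae) ?_⟩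
    -- The bound on the approximations is inherited by the limit, which gives its integrability.
    filter_upwards [hae, ae_all_iff.2 hb] with p hp hbp
    exact le_of_tendsto hp.norm (Eventually.of_forall hbp)
  obtain ⟨tA, iA⟩ := hT hA
  obtain ⟨tB, iB⟩ := hT hB
  refine ⟨_, ?_, tA.add tB⟩
  rw [← integral_add iA iB]
  exact integral_nonpos_of_ae (hA.pairDiff_add_pairDiff_nonpos hr hB hf hfAB)

end PairDiff

end MinkowskiFlow

/-! ### Mollification by bump functions. -/

namespace MinkowskiFlow

open scoped Convolution Pointwise

section Mollify

set_option linter.unusedSectionVars false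

variable {G : Type*} [NormedAddCommGroup G] [NormedSpace ℝ G] [FiniteDimensional ℝ G]
  [MeasurableSpace G] [BorelSpace G] {μ : Measure G} [μ.IsAddHaarMeasure]

/-- The mollification of a function by a normalized bump function. -/
noncomputable def mollify (μ : Measure G) (ρ : ContDiffBump (0 : G)) (A : G → ℝ) : G → ℝ :=
  ρ.normed μ ⋆[ContinuousLinearMap.lsmul ℝ ℝ, μ] A

theorem mollify_apply (ρ : ContDiffBump (0 : G)) (A : G → ℝ) (p : G) :
    mollify μ ρ A p = ∫ t, ρ.normed μ t * A (p - t) ∂μ := rfl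

theorem contDiff_mollify (ρ : ContDiffBump (0 : G)) {A : G → ℝ} (hA : LocallyIntegrable A μ) :
    ContDiff ℝ ∞ (mollify μ ρ A) :=
  ρ.hasCompactSupport_normed.contDiff_convolution_left _ ρ.contDiff_normed hA

theorem integrable_mollify_integrand (ρ : ContDiffBump (0 : G)) {A : G → ℝ}
    (hA : LocallyIntegrable A μ) (p : G) : Integrable (fun t => ρ.normed μ t * A (p - t)) μ :=
  ρ.hasCompactSupport_normed.convolutionExists_left (ContinuousLinearMap.lsmul ℝ ℝ)
    ρ.continuous_normed hA p

theorem mollify_integrand_mono (ρ : ContDiffBump (0 : G)) {u v : G → ℝ} {p : G}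
    (h : ∀ q ∈ Metric.ball p ρ.rOut, u q ≤ v q) (t : G) :
    ρ.normed μ t * u (p - t) ≤ ρ.normed μ t * v (p - t) := by
  by_cases ht : t ∈ Metric.ball (0 : G) ρ.rOut
  · refine mul_le_mul_of_nonneg_left (h _ ?_) (ρ.nonneg_normed t)
    simpa using ht
  · have : ρ.normed μ t = 0 := by
      by_contra hne
      exact ht (ρ.support_normed_eq (μ := μ) ▸ hne)
    simp [this]

theorem mollify_le_of_le (ρ : ContDiffBump (0 : G)) {A : G → ℝ} (hA : LocallyIntegrable A μ)
    {p : G} {c : ℝ} (h : ∀ q ∈ Metric.ball p ρ.rOut, A q ≤ c) : mollify μ ρ A p ≤ c := by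
  have h1 : ∫ t, ρ.normed μ t * c ∂μ = c := by
    rw [integral_mul_const, ρ.integral_normed, one_mul]
  rw [mollify_apply, ← h1]
  exact integral_mono (integrable_mollify_integrand ρ hA p) (ρ.integrable_normed.mul_const c)
    (mollify_integrand_mono ρ (v := fun _ => c) h)

theorem le_mollify_of_le (ρ : ContDiffBump (0 : G)) {A : G → ℝ} (hA : LocallyIntegrable A μ)
    {p : G} {c : ℝ} (h : ∀ q ∈ Metric.ball p ρ.rOut, c ≤ A q) : c ≤ mollify μ ρ A p := by
  have h1 : ∫ t, ρ.normed μ t * c ∂μ = c := by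
    rw [integral_mul_const, ρ.integral_normed, one_mul]
  rw [mollify_apply, ← h1]
  exact integral_mono (ρ.integrable_normed.mul_const c) (integrable_mollify_integrand ρ hA p)
    (mollify_integrand_mono ρ (u := fun _ => c) h)

theorem mollify_sub_le (ρ : ContDiffBump (0 : G)) {A : G → ℝ} (hA : LocallyIntegrable A μ)
    {p p' : G} {c : ℝ} (h : ∀ t, A (p - t) - A (p' - t) ≤ c) :
    mollify μ ρ A p - mollify μ ρ A p' ≤ c := by
  have h1 : ∫ t, ρ.normed μ t * c ∂μ = c := by
    rw [integral_mul_const, ρ.integral_normed, one_mul]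
  rw [mollify_apply, mollify_apply, ← integral_sub (integrable_mollify_integrand ρ hA p)
    (integrable_mollify_integrand ρ hA p'), ← h1]
  refine integral_mono ((integrable_mollify_integrand ρ hA p).sub
    (integrable_mollify_integrand ρ hA p')) (ρ.integrable_normed.mul_const c) fun t => ?_
  have := mul_le_mul_of_nonneg_left (h t) (ρ.nonneg_normed (μ := μ) t)
  simp only
  linarith

theorem mollify_sub_mul (ρ : ContDiffBump (0 : G)) {u v : G → ℝ} (hu : LocallyIntegrable u μ)
    (hv : LocallyIntegrable v μ) (c : ℝ) (p : G) :
    mollify μ ρ (fun q => u q - c * v q) p = mollify μ ρ u p - c * mollify μ ρ v p := by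
  rw [mollify_apply, mollify_apply, mollify_apply, ← integral_const_mul,
    ← integral_sub (integrable_mollify_integrand ρ hu p)
      ((integrable_mollify_integrand ρ hv p).const_mul c)]
  congr 1
  funext t
  ring

theorem abs_mollify_sub_le (ρ : ContDiffBump (0 : G)) {u v : G → ℝ} (hu : LocallyIntegrable u μ)
    (hv : LocallyIntegrable v μ) (p : G) :
    |mollify μ ρ u p - mollify μ ρ v p| ≤ mollify μ ρ (fun q => |u q - v q|) p := by
  rw [mollify_apply, mollify_apply, mollify_apply,
    ← integral_sub (integrable_mollify_integrand ρ hu p) (integrable_mollify_integrand ρ hv p)]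
  refine (abs_integral_le_integral_abs).trans (le_of_eq ?_)
  congr 1
  funext t
  rw [← mul_sub, abs_mul, abs_of_nonneg (ρ.nonneg_normed t)]

theorem mollify_nonneg (ρ : ContDiffBump (0 : G)) {A : G → ℝ} (hA : ∀ p, 0 ≤ A p) (p : G) :
    0 ≤ mollify μ ρ A p :=
  integral_nonneg fun t => mul_nonneg (ρ.nonneg_normed t) (hA _)

theorem integral_mollify (ρ : ContDiffBump (0 : G)) {A : G → ℝ} (hA : Integrable A μ) :
    ∫ p, mollify μ ρ A p ∂μ = ∫ p, A p ∂μ := by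
  rw [mollify, integral_convolution _ ρ.integrable_normed hA, ρ.integral_normed]
  simp

theorem integrable_mollify (ρ : ContDiffBump (0 : G)) {A : G → ℝ} (hA : Integrable A μ) :
    Integrable (mollify μ ρ A) μ :=
  ρ.integrable_normed.integrable_convolution _ hA

theorem exists_ne_zero_of_mollify_ne_zero {ρ : ContDiffBump (0 : G)} {A : G → ℝ} {p : G}
    (h : mollify μ ρ A p ≠ 0) : ∃ q ∈ Metric.ball p ρ.rOut, A q ≠ 0 := by
  by_contra! hcon
  refine h (integral_eq_zero_of_ae (Eventually.of_forall fun t => ?_))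
  have h1 := mollify_integrand_mono (μ := μ) ρ (u := A) (v := fun _ => 0)
    (fun q hq => (hcon q hq).le) t
  have h2 := mollify_integrand_mono (μ := μ) ρ (u := fun _ => 0) (v := A)
    (fun q hq => (hcon q hq).ge) t
  have : ρ.normed μ t * A (p - t) = 0 := by linarith
  exact this

/-- Fubini applies although `A` is only locally integrable: the double integral involves `A` only on
the compact set `tsupport ψ - tsupport k`. -/
theorem integral_integral_kernel_swap {k ψ A : G → ℝ} (hk : Continuous k)
    (hkc : HasCompactSupport k) (hψ : Continuous ψ) (hψc : HasCompactSupport ψ)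
    (hA : LocallyIntegrable A μ) :
    ∫ p, ψ p * ∫ q, k (p - q) * A q ∂μ ∂μ = ∫ q, A q * ∫ p, k (p - q) * ψ p ∂μ ∂μ := by
  have hK : IsCompact (tsupport ψ + -tsupport k) := IsCompact.add hψc (IsCompact.neg hkc)
  obtain ⟨C, hC⟩ := hkc.exists_bound_of_continuous hk
  have hint : Integrable (Function.uncurry fun p q => ψ p * (k (p - q) * A q)) (μ.prod μ) := by
    have h1 : Integrable (fun z : G × G => (C * ‖ψ z.1‖) *
        ‖(tsupport ψ + -tsupport k).indicator A z.2‖) (μ.prod μ) :=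
      ((hψ.integrable_of_hasCompactSupport hψc).norm.const_mul C).mul_prod
        ((integrable_indicator_iff hK.measurableSet).2 (hA.integrableOn_isCompact hK)).norm
    refine h1.mono' ?_ (Eventually.of_forall fun z => ?_)
    · refine AEStronglyMeasurable.mul (hψ.comp continuous_fst).aestronglyMeasurable
        (AEStronglyMeasurable.mul (hk.comp (continuous_fst.sub
          continuous_snd)).aestronglyMeasurable ?_)
      exact hA.aestronglyMeasurable.comp_snd
    · obtain ⟨p, q⟩ := z
      simp only [Function.uncurry_apply_pair]
      by_cases hp : ψ p = 0
      · simp [hp]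
      by_cases hkq : k (p - q) = 0
      · rw [hkq]
        simp only [zero_mul, mul_zero, norm_zero]
        have := (norm_nonneg _).trans (hC 0)
        positivity
      have hq : q ∈ tsupport ψ + -tsupport k :=
        Set.mem_add.2 ⟨p, subset_tsupport ψ hp, -(p - q),
          Set.neg_mem_neg.2 (subset_tsupport k hkq), by abel⟩
      rw [Set.indicator_of_mem hq, norm_mul, norm_mul]
      have := mul_le_mul_of_nonneg_right (hC (p - q)) (mul_nonneg (norm_nonneg (ψ p))
        (norm_nonneg (A q)))
      linarith
  calc ∫ p, ψ p * ∫ q, k (p - q) * A q ∂μ ∂μ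
      = ∫ p, ∫ q, ψ p * (k (p - q) * A q) ∂μ ∂μ := by simp_rw [integral_const_mul]
    _ = ∫ q, ∫ p, ψ p * (k (p - q) * A q) ∂μ ∂μ := integral_integral_swap hint
    _ = ∫ q, A q * ∫ p, k (p - q) * ψ p ∂μ ∂μ := by
      simp_rw [← integral_const_mul]
      congr 1; funext q; congr 1; funext p; ring

theorem fderiv_mollify (ρ : ContDiffBump (0 : G)) {A : G → ℝ} (hA : LocallyIntegrable A μ)
    (p v : G) : fderiv ℝ (mollify μ ρ A) p v =
      ∫ q, fderiv ℝ (ρ.normed μ) (p - q) v * A q ∂μ := by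
  have h1 : ContDiff ℝ 1 (ρ.normed μ) := ρ.contDiff_normed
  rw [mollify, (ρ.hasCompactSupport_normed.hasFDerivAt_convolution_left
    (ContinuousLinearMap.lsmul ℝ ℝ) h1 hA p).fderiv]
  have h2 : ConvolutionExistsAt (fderiv ℝ (ρ.normed μ)) A p
      ((ContinuousLinearMap.lsmul ℝ ℝ : ℝ →L[ℝ] ℝ →L[ℝ] ℝ).precompL G) μ :=
    (ρ.hasCompactSupport_normed.fderiv ℝ).convolutionExists_left _
      (h1.continuous_fderiv one_ne_zero) hA p
  rw [convolution_eq_swap, ContinuousLinearMap.integral_apply h2.integrable_swap]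
  rfl

/-- The derivative of the mollification is skew-adjoint. -/
theorem integral_mul_fderiv_mollify (ρ : ContDiffBump (0 : G)) {A ψ : G → ℝ}
    (hA : LocallyIntegrable A μ) (hψ : Continuous ψ) (hψc : HasCompactSupport ψ) (v : G) :
    ∫ p, ψ p * fderiv ℝ (mollify μ ρ A) p v ∂μ =
      -∫ p, A p * fderiv ℝ (mollify μ ρ ψ) p v ∂μ := by
  have h1 : ContDiff ℝ 1 (ρ.normed μ) := ρ.contDiff_normed
  have hk : Continuous fun p => fderiv ℝ (ρ.normed μ) p v :=
    (h1.continuous_fderiv one_ne_zero).clm_apply continuous_const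
  have hkc : HasCompactSupport fun p => fderiv ℝ (ρ.normed μ) p v :=
    (ρ.hasCompactSupport_normed.fderiv ℝ).comp_left (g := fun f : G →L[ℝ] ℝ => f v) rfl
  -- The kernel is even, so its derivative is odd; this is where the sign of the skew-adjointness
  -- comes from.
  have hodd : ∀ p, fderiv ℝ (ρ.normed μ) (-p) v = -fderiv ℝ (ρ.normed μ) p v := by
    intro p
    have h2 : (fun x => ρ.normed μ (-x)) = ρ.normed μ := funext fun x => ρ.normed_neg x
    have h3 := fderiv_comp_smul (𝕜 := ℝ) (f := ρ.normed μ) (x := p) (-1 : ℝ)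
    simp only [neg_one_smul, h2] at h3
    rw [h3]
    simp
  simp_rw [fderiv_mollify ρ hA, fderiv_mollify ρ (hψ.locallyIntegrable)]
  rw [integral_integral_kernel_swap hk hkc hψ hψc hA, ← integral_neg]
  congr 1
  funext q
  rw [← mul_neg, ← integral_neg]
  congr 2
  funext p
  rw [← neg_sub q p, hodd]
  ring

end Mollify

end MinkowskiFlow

/-! ### The bending function and tested supersolutions. -/

namespace MinkowskiFlow

open scoped Convolution Pointwise

/-- Half the square of the positive part. -/
noncomputable def posSq (y : ℝ) : ℝ := max y 0 ^ 2 / 2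

theorem hasDerivAt_posSq (y : ℝ) : HasDerivAt posSq (max y 0) y := by
  rcases lt_trichotomy y 0 with h | h | h
  · rw [max_eq_right h.le]
    refine (hasDerivAt_const y (0 : ℝ)).congr_of_eventuallyEq ?_
    filter_upwards [Iio_mem_nhds h] with u hu
    simp [posSq, max_eq_right (Set.mem_Iio.1 hu).le]
  · subst h
    rw [max_self, hasDerivAt_iff_isLittleO_nhds_zero]
    simp only [zero_add, posSq, max_self, smul_zero, sub_zero]
    have h1 : (fun h : ℝ => max h 0 ^ 2 / 2 - 0 ^ 2 / 2) =O[𝓝 0] fun h : ℝ => h ^ 2 := by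
      refine Asymptotics.IsBigO.of_bound 1 (Eventually.of_forall fun u => ?_)
      have h2 := sq_nonneg u
      rw [Real.norm_eq_abs, Real.norm_eq_abs, abs_of_nonneg h2, one_mul, abs_le]
      rcases le_total u 0 with hu | hu
      · rw [max_eq_right hu]; constructor <;> linarith
      · rw [max_eq_left hu]; constructor <;> linarith
    exact h1.trans_isLittleO (by simpa using Asymptotics.isLittleO_pow_pow (𝕜 := ℝ) one_lt_two)
  · rw [max_eq_left h.le]
    have h1 : HasDerivAt (fun u : ℝ => u ^ 2 / 2) y y := by
      exact ((hasDerivAt_pow 2 y).div_const 2).congr_deriv (by norm_num)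
    refine h1.congr_of_eventuallyEq ?_
    filter_upwards [Ioi_mem_nhds h] with u hu
    simp [posSq, max_eq_left (Set.mem_Ioi.1 hu).le]

theorem contDiff_posSq : ContDiff ℝ 1 posSq := by
  rw [contDiff_one_iff_deriv]
  refine ⟨fun y => (hasDerivAt_posSq y).differentiableAt, ?_⟩
  have : deriv posSq = fun y => max y 0 := funext fun y => (hasDerivAt_posSq y).deriv
  rw [this]
  fun_prop

theorem posSq_nonneg (y : ℝ) : 0 ≤ posSq y := by unfold posSq; positivity

theorem posSq_eq_zero_iff {y : ℝ} : posSq y = 0 ↔ y ≤ 0 := by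
  unfold posSq
  constructor
  · intro h
    by_contra! hy
    rw [max_eq_left hy.le] at h
    nlinarith
  · intro h
    simp [max_eq_right h]

theorem posSq_mono {x y : ℝ} (h : x ≤ y) : posSq x ≤ posSq y := by
  unfold posSq
  have : max x 0 ≤ max y 0 := max_le_max_right 0 h
  have h0 : 0 ≤ max x 0 := le_max_right _ _
  nlinarith

/-- A perturbation of the identity of the half-line which lifts the values below `η`. -/
noncomputable def bend (ε η a : ℝ) : ℝ := a + ε * posSq (η - a)

noncomputable def bendDeriv (ε η a : ℝ) : ℝ := 1 - ε * max (η - a) 0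

theorem hasDerivAt_bend (ε η a : ℝ) : HasDerivAt (bend ε η) (bendDeriv ε η a) a := by
  have h1 : HasDerivAt (fun a => posSq (η - a)) (max (η - a) 0 * -1) a :=
    (hasDerivAt_posSq (η - a)).comp a ((hasDerivAt_id a).const_sub η)
  have h2 := (hasDerivAt_id a).add (h1.const_mul ε)
  unfold bend bendDeriv
  have h3 : (1 : ℝ) - ε * max (η - a) 0 = 1 + ε * (max (η - a) 0 * -1) := by ring
  rw [h3]
  exact h2

theorem contDiff_bend (ε η : ℝ) : ContDiff ℝ 1 (bend ε η) :=
  contDiff_id.add (contDiff_const.mul (contDiff_posSq.comp (contDiff_const.sub contDiff_id)))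

theorem le_bend {ε : ℝ} (hε : 0 ≤ ε) (η a : ℝ) : a ≤ bend ε η a :=
  le_add_of_nonneg_right (mul_nonneg hε (posSq_nonneg _))

theorem bend_of_le {ε η a : ℝ} (h : η ≤ a) : bend ε η a = a := by
  rw [bend, posSq_eq_zero_iff.2 (by linarith)]; ring

/-- On the half-line `max (η - a) 0` is at most `η` (for `η ≥ 0`), so `ε * η ≤ 1` keeps the slope
nonnegative. Monotonicity is what lets the sign of the calibration terms survive the bending. -/
theorem bend_mono {ε η : ℝ} (hε : 0 ≤ ε) (hεη : ε * η ≤ 1) {a b : ℝ} (ha : 0 ≤ a) (hab : a ≤ b) :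
    bend ε η a ≤ bend ε η b := by
  unfold bend posSq
  have h1 : max (η - a) 0 - max (η - b) 0 ≤ b - a := by
    rcases le_total (η - a) 0 with h | h
    · rw [max_eq_right h]
      have := le_max_right (η - b) 0
      linarith
    · rw [max_eq_left h]
      have := le_max_left (η - b) 0
      linarith
  have h2 : max (η - b) 0 ≤ max (η - a) 0 := max_le_max_right 0 (by linarith)
  have h3 : 0 ≤ max (η - b) 0 := le_max_right _ _
  rcases le_total η 0 with hη | hη
  · rw [max_eq_right (by linarith), max_eq_right (by linarith)]
    simpa using hab
  have h4 : max (η - a) 0 ≤ η := max_le (by linarith) hη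
  set x := max (η - a) 0
  set y := max (η - b) 0
  have h5 : ε * (x ^ 2 / 2 - y ^ 2 / 2) ≤ x - y := by
    have h6 : x ^ 2 / 2 - y ^ 2 / 2 = (x - y) * ((x + y) / 2) := by ring
    have h7 : ε * ((x + y) / 2) ≤ 1 :=
      (mul_le_mul_of_nonneg_left (by linarith : (x + y) / 2 ≤ η) hε).trans hεη
    rw [h6]
    calc ε * ((x - y) * ((x + y) / 2)) = (x - y) * (ε * ((x + y) / 2)) := by ring
      _ ≤ (x - y) * 1 := mul_le_mul_of_nonneg_left h7 (by linarith)
      _ = x - y := mul_one _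
  linarith

/-- `A` is a calibrated distributional supersolution on the time interval `[α, β]`, away from its
zero level set. -/
structure IsLocalSupersolution {N : ℕ} (r α β ℓ M : ℝ) (A : Space N × ℝ → ℝ)
    (z : Space N × ℝ → FiniteMeasure (pairBall N r)) : Prop
    extends IsCalibration r (Set.univ ×ˢ Set.Icc α β) A z where
  nonneg : ∀ p, 0 ≤ A p
  locallyIntegrable : LocallyIntegrable A
  evolution : ∀ φ : Space N × ℝ → ℝ, ContDiff ℝ ∞ φ → HasCompactSupport φ →
    (∀ p ∈ tsupport φ, p.2 ∈ Set.Icc α β ∧ ℓ ≤ A p) → (∀ p, 0 ≤ φ p) →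
    -(1 / (2 * r)) * ∫ p in Set.univ ×ˢ Set.Icc α β, pairDiff z φ p ≤
      -∫ p, A p * fderiv ℝ φ p (0, 1)
  div_le : ∀ φ : Space N × ℝ → ℝ, ContDiff ℝ ∞ φ → HasCompactSupport φ →
    (∀ p ∈ tsupport φ, p.2 ∈ Set.Icc α β ∧ ℓ ≤ A p) → (∀ p, 0 ≤ φ p) →
    -(1 / (2 * r)) * ∫ p in Set.univ ×ˢ Set.Icc α β, pairDiff z φ p ≤ M * ∫ p, φ p

section Energy

variable {N : ℕ} {r α β ℓ M : ℝ} {A B : Space N × ℝ → ℝ}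
  {z y : Space N × ℝ → FiniteMeasure (pairBall N r)}

instance isAddHaarMeasure_volume_spaceTime :
    (volume : Measure (Space N × ℝ)).IsAddHaarMeasure :=
  inferInstanceAs (Measure.IsAddHaarMeasure ((volume : Measure (Space N)).prod volume))

theorem exists_dist_lt_of_mem_tsupport_mollify {ρ : ContDiffBump (0 : Space N × ℝ)}
    {ψ : Space N × ℝ → ℝ} {p : Space N × ℝ} (hp : p ∈ tsupport (mollify volume ρ ψ)) :
    ∃ q, ψ q ≠ 0 ∧ dist p q < 2 * ρ.rOut := by
  obtain ⟨p', hp', hd⟩ := Metric.mem_closure_iff.1 hp ρ.rOut ρ.rOut_pos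
  obtain ⟨q, hq, hne⟩ := exists_ne_zero_of_mollify_ne_zero hp'
  refine ⟨q, hne, ?_⟩
  have := dist_triangle p p' q
  rw [Metric.mem_ball, dist_comm] at hq
  linarith

theorem hasCompactSupport_mollify (ρ : ContDiffBump (0 : Space N × ℝ)) {ψ : Space N × ℝ → ℝ}
    (hψ : HasCompactSupport ψ) : HasCompactSupport (mollify volume ρ ψ) :=
  ρ.hasCompactSupport_normed.convolution _ hψ

theorem exists_box_of_hasCompactSupport {φ : Space N × ℝ → ℝ} (hφ : HasCompactSupport φ)
    (hJ : ∀ p, φ p ≠ 0 → p.2 ∈ Set.Icc α β) :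
    ∃ R, ∀ p, φ p ≠ 0 → ‖p.1‖ ≤ R ∧ p.2 ∈ Set.Icc α β := by
  obtain ⟨R, hR⟩ := hφ.isCompact.isBounded.exists_norm_le
  exact ⟨R, fun p hp => ⟨(norm_fst_le p).trans (hR p (subset_tsupport φ hp)), hJ p hp⟩⟩

theorem IsCalibration.integral_pairDiff_sub_mul {W : Set (Space N × ℝ)}
    (h : IsCalibration r W A z) {φ ψ : Space N × ℝ → ℝ}
    (hφ : Continuous φ) (hφc : HasCompactSupport φ) (hψ : Continuous ψ)
    (hψc : HasCompactSupport ψ) (c : ℝ) :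
    ∫ p in W, pairDiff z (fun p => φ p - c * ψ p) p =
      (∫ p in W, pairDiff z φ p) - c * ∫ p in W, pairDiff z ψ p := by
  have hi : ∀ {φ : Space N × ℝ → ℝ}, Continuous φ → HasCompactSupport φ →
      IntegrableOn (pairDiff z φ) W := by
    intro φ hφ hφc
    obtain ⟨C, hC⟩ := hφc.exists_bound_of_continuous hφ
    obtain ⟨R, hR⟩ := hφc.isCompact.isBounded.exists_norm_le
    refine h.integrableOn_pairDiff hφ (C := C) (R := R) (α := -R) (β := R) hC fun p hp => ?_
    have h1 := hR p (subset_tsupport φ hp)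
    exact ⟨(norm_fst_le p).trans h1, abs_le.1 ((norm_snd_le p).trans h1)⟩
  rw [← integral_const_mul, ← integral_sub (hi hφ hφc) ((hi hψ hψc).const_mul c)]
  congr 1
  funext p
  exact pairDiff_sub_mul hφ hψ c p

/-- The evolution inequality tested with a mollification, where the factor `bendDeriv` is absorbed
with the help of the upper bound on the divergence. -/
theorem IsLocalSupersolution.le_integral_mul_bendDeriv (hA : IsLocalSupersolution r α β ℓ M A z)
    (ρ : ContDiffBump (0 : Space N × ℝ)) {q a : Space N × ℝ → ℝ} (hq : Continuous q)
    (hqc : HasCompactSupport q) (hq0 : ∀ p, 0 ≤ q p) (ha : Continuous a) (ha0 : ∀ p, 0 ≤ a p)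
    (hqs : ∀ p, q p ≠ 0 → ∀ p', dist p' p < 2 * ρ.rOut → p'.2 ∈ Set.Icc α β ∧ ℓ ≤ A p')
    {ε η : ℝ} (hε : 0 ≤ ε) (hη : 0 ≤ η) (hεη : ε * η ≤ 1) (hM : 0 ≤ M) :
    -(1 / (2 * r)) * (∫ p in Set.univ ×ˢ Set.Icc α β, pairDiff z (mollify volume ρ q) p) -
        ε * η * M * ∫ p, q p ≤
      ∫ p, q p * bendDeriv ε η (a p) * fderiv ℝ (mollify volume ρ A) p (0, 1) := by
  set s : Space N × ℝ → ℝ := fun p => q p * max (η - a p) 0 with hs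
  have hsc : Continuous s := by fun_prop
  have hscs : HasCompactSupport s := hqc.mul_right
  have hs0 : ∀ p, 0 ≤ s p := fun p => mul_nonneg (hq0 p) (le_max_right _ _)
  have hsη : ∀ p, s p ≤ η * q p := fun p => by
    rw [mul_comm η]
    exact mul_le_mul_of_nonneg_left (max_le (by linarith [ha0 p]) hη) (hq0 p)
  -- The weighted test function is split as `q - ε * s` with `0 ≤ s ≤ η * q`. The evolution
  -- inequality is used for the difference, and the divergence bound for the subtracted part `s`,
  -- which costs at most `ε * η * M * ∫ q`.
  have hψ : (fun p => q p * bendDeriv ε η (a p)) = fun p => q p - ε * s p := by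
    funext p; simp only [bendDeriv, hs]; ring
  have hψ0 : ∀ p, 0 ≤ q p - ε * s p := fun p => by
    have := mul_le_mul_of_nonneg_left (hsη p) hε
    nlinarith [hq0 p]
  have hψc : Continuous fun p => q p - ε * s p := by fun_prop
  have hψcs : HasCompactSupport fun p => q p - ε * s p := by
    rw [← hψ]; exact hqc.mul_right
  have hsupp : ∀ {ψ : Space N × ℝ → ℝ}, (∀ p, ψ p ≠ 0 → q p ≠ 0) →
      ∀ p ∈ tsupport (mollify volume ρ ψ), p.2 ∈ Set.Icc α β ∧ ℓ ≤ A p := by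
    intro ψ hψ p hp
    obtain ⟨p', hp', hd⟩ := exists_dist_lt_of_mem_tsupport_mollify hp
    exact hqs p' (hψ p' hp') p hd
  -- Skew-adjointness moves the mollification from `A` to the test function, where the
  -- distributional inequality can be applied.
  have hmul := integral_mul_fderiv_mollify ρ hA.locallyIntegrable hψc hψcs (0, 1)
  have hev := hA.evolution _ (contDiff_mollify ρ hψc.locallyIntegrable)
    (hasCompactSupport_mollify ρ hψcs)
    (hsupp fun p hp h => hp (by simp [hs, h])) (mollify_nonneg ρ hψ0)
  have hdiv := hA.div_le _ (contDiff_mollify ρ hsc.locallyIntegrable)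
    (hasCompactSupport_mollify ρ hscs)
    (hsupp fun p hp h => hp (by simp [hs, h])) (mollify_nonneg ρ hs0)
  have hfun : mollify volume ρ (fun p => q p - ε * s p) =
      fun p => mollify volume ρ q p - ε * mollify volume ρ s p :=
    funext fun p => mollify_sub_mul ρ hq.locallyIntegrable hsc.locallyIntegrable ε p
  rw [hfun] at hev
  rw [hA.toIsCalibration.integral_pairDiff_sub_mul
    (contDiff_mollify ρ hq.locallyIntegrable).continuous (hasCompactSupport_mollify ρ hqc)
    (contDiff_mollify ρ hsc.locallyIntegrable).continuous (hasCompactSupport_mollify ρ hscs)] at hev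
  rw [integral_mollify ρ (hsc.integrable_of_hasCompactSupport hscs)] at hdiv
  have hint : ∫ p, s p ≤ η * ∫ p, q p := by
    rw [← integral_const_mul]
    exact integral_mono (hsc.integrable_of_hasCompactSupport hscs)
      ((hq.integrable_of_hasCompactSupport hqc).const_mul η) hsη
  have heq : ∫ p, q p * bendDeriv ε η (a p) * fderiv ℝ (mollify volume ρ A) p (0, 1) =
      ∫ p, (q p - ε * s p) * fderiv ℝ (mollify volume ρ A) p (0, 1) := by
    congr 1
    funext p
    rw [← congrFun hψ p]
  rw [heq, hmul, hfun]
  have h1 : ε * (M * ∫ p, s p) ≤ ε * (M * (η * ∫ p, q p)) := by gcongr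
  have h2 := mul_le_mul_of_nonneg_left hdiv hε
  linarith

end Energy

end MinkowskiFlow

/-! ### The energy inequality for mollified distances. -/

namespace MinkowskiFlow

open scoped Convolution Pointwise

/-- The perturbed sum of two distance functions. -/
noncomputable def level {N : ℕ} (ε η m α : ℝ) (A B : Space N × ℝ → ℝ) (p : Space N × ℝ) : ℝ :=
  bend ε η (A p) + bend ε η (B p) + m * (p.2 - α)

section Energy

variable {N : ℕ} {r α β ℓ M : ℝ} {A B : Space N × ℝ → ℝ}
  {z y : Space N × ℝ → FiniteMeasure (pairBall N r)}

theorem contDiff_level {ε η m α : ℝ} (hA : ContDiff ℝ 1 A) (hB : ContDiff ℝ 1 B) :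
    ContDiff ℝ 1 (level ε η m α A B) :=
  (((contDiff_bend ε η).comp hA).add ((contDiff_bend ε η).comp hB)).add
    (contDiff_const.mul (contDiff_snd.sub contDiff_const))

theorem fderiv_level {ε η m α : ℝ} (hA : ContDiff ℝ 1 A) (hB : ContDiff ℝ 1 B)
    (p : Space N × ℝ) : fderiv ℝ (level ε η m α A B) p (0, 1) =
      bendDeriv ε η (A p) * fderiv ℝ A p (0, 1) + bendDeriv ε η (B p) * fderiv ℝ B p (0, 1) + m := by
  have h1 := (hasDerivAt_bend ε η (A p)).comp_hasFDerivAt p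
    (hA.differentiable one_ne_zero p).hasFDerivAt
  have h2 := (hasDerivAt_bend ε η (B p)).comp_hasFDerivAt p
    (hB.differentiable one_ne_zero p).hasFDerivAt
  have h3 : HasFDerivAt (fun p : Space N × ℝ => m * (p.2 - α))
      (m • ContinuousLinearMap.snd ℝ (Space N) ℝ) p :=
    (hasFDerivAt_snd.sub_const α).const_mul m
  have h4 : HasFDerivAt (level ε η m α A B) _ p := (h1.add h2).add h3
  rw [h4.fderiv]
  simp

theorem fderiv_posSq_sub {L : Space N × ℝ → ℝ} (hL : ContDiff ℝ 1 L) (D : ℝ) (p : Space N × ℝ) :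
    fderiv ℝ (fun p => posSq (D - L p)) p (0, 1) =
      -(max (D - L p) 0 * fderiv ℝ L p (0, 1)) := by
  have h1 := (hasDerivAt_posSq (D - L p)).comp_hasFDerivAt p
    ((hL.differentiable one_ne_zero p).hasFDerivAt.const_sub D)
  have h2 : posSq ∘ (fun p => D - L p) = fun p => posSq (D - L p) := rfl
  rw [h2] at h1
  rw [h1.fderiv]
  simp

theorem fderiv_comp_snd {θ : ℝ → ℝ} (hθ : ContDiff ℝ 1 θ) (p : Space N × ℝ) :
    fderiv ℝ (fun p : Space N × ℝ => θ p.2) p (0, 1) = deriv θ p.2 := by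
  have h1 := (hθ.differentiable one_ne_zero p.2).hasDerivAt.comp_hasFDerivAt p
    (hasFDerivAt_snd (𝕜 := ℝ) (E := Space N) (F := ℝ) (p := p))
  have h2 : θ ∘ Prod.snd = fun p : Space N × ℝ => θ p.2 := rfl
  rw [h2] at h1
  rw [h1.fderiv]
  simp

/-- Zeros of a nonnegative function are minima. Hence terms containing `θ'` are confined by the same
support conditions as those containing `θ`. -/
theorem deriv_eq_zero_of_nonneg {θ : ℝ → ℝ} (hθ0 : ∀ t, 0 ≤ θ t) {t : ℝ} (ht : θ t = 0) :
    deriv θ t = 0 := by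
  have : IsLocalMin θ t := Eventually.of_forall fun s => by rw [ht]; exact hθ0 s
  exact this.deriv_eq_zero

theorem hasCompactSupport_of_box {φ : Space N × ℝ → ℝ} {R α β : ℝ}
    (hφ : ∀ p, φ p ≠ 0 → ‖p.1‖ ≤ R ∧ p.2 ∈ Set.Icc α β) : HasCompactSupport φ :=
  HasCompactSupport.intro (isCompact_box N R α β) fun p hp => by
    by_contra h
    exact hp (hφ p h)

/-- The energy inequality for mollified distance functions. -/
theorem IsLocalSupersolution.energy_mollify (hA : IsLocalSupersolution r α β ℓ M A z)
    (hB : IsLocalSupersolution r α β ℓ M B y) (ρ : ContDiffBump (0 : Space N × ℝ))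
    {θ : ℝ → ℝ} (hθ : ContDiff ℝ 1 θ) (hθ0 : ∀ t, 0 ≤ θ t) {ε η m D R : ℝ}
    (hε : 0 ≤ ε) (hη : 0 ≤ η) (hεη : ε * η ≤ 1) (hM : 0 ≤ M) (hm : 2 * (ε * η * M) ≤ m)
    (hbox : ∀ p, θ p.2 ≠ 0 → level ε η m α (mollify volume ρ A) (mollify volume ρ B) p < D →
      ‖p.1‖ ≤ R ∧ p.2 ∈ Set.Icc α β)
    (hs : ∀ p, θ p.2 ≠ 0 → level ε η m α (mollify volume ρ A) (mollify volume ρ B) p < D →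
      ∀ p', dist p' p < 2 * ρ.rOut → p'.2 ∈ Set.Icc α β ∧ ℓ ≤ A p' ∧ ℓ ≤ B p') :
    -∫ p : Space N × ℝ, deriv θ p.2 *
        posSq (D - level ε η m α (mollify volume ρ A) (mollify volume ρ B) p) ≤
      1 / (2 * r) * ((∫ p in Set.univ ×ˢ Set.Icc α β, pairDiff z (mollify volume ρ fun p =>
          θ p.2 * max (D - level ε η m α (mollify volume ρ A) (mollify volume ρ B) p) 0) p) +
        ∫ p in Set.univ ×ˢ Set.Icc α β, pairDiff y (mollify volume ρ fun p =>
          θ p.2 * max (D - level ε η m α (mollify volume ρ A) (mollify volume ρ B) p) 0) p) := by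
  set a := mollify volume ρ A with ha
  set b := mollify volume ρ B with hb
  set L := level ε η m α a b with hL
  set q : Space N × ℝ → ℝ := fun p => θ p.2 * max (D - L p) 0 with hq
  have hac : ContDiff ℝ 1 a := (contDiff_mollify ρ hA.locallyIntegrable).of_le (by simp)
  have hbc : ContDiff ℝ 1 b := (contDiff_mollify ρ hB.locallyIntegrable).of_le (by simp)
  have ha0 : ∀ p, 0 ≤ a p := mollify_nonneg ρ hA.nonneg
  have hb0 : ∀ p, 0 ≤ b p := mollify_nonneg ρ hB.nonneg
  have hLc : ContDiff ℝ 1 L := contDiff_level hac hbc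
  have hqc : Continuous q := by
    have := hLc.continuous
    have := hθ.continuous
    fun_prop
  have hq0 : ∀ p, 0 ≤ q p := fun p => mul_nonneg (hθ0 _) (le_max_right _ _)
  have hqne : ∀ p, q p ≠ 0 → θ p.2 ≠ 0 ∧ L p < D := by
    intro p hp
    refine ⟨left_ne_zero_of_mul hp, ?_⟩
    by_contra! h
    exact right_ne_zero_of_mul hp (max_eq_right (by linarith))
  have hqcs : HasCompactSupport q :=
    hasCompactSupport_of_box fun p hp => hbox p (hqne p hp).1 (hqne p hp).2
  have hgc : ContDiff ℝ 1 fun p => posSq (D - L p) :=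
    contDiff_posSq.comp (contDiff_const.sub hLc)
  have hgne : ∀ p, posSq (D - L p) ≠ 0 → L p < D := by
    intro p hp
    by_contra! h
    exact hp (posSq_eq_zero_iff.2 (by linarith))
  have hθc : ContDiff ℝ 1 fun p : Space N × ℝ => θ p.2 := hθ.comp contDiff_snd
  have hvc : ∀ {f : Space N × ℝ → ℝ}, ContDiff ℝ 1 f → Continuous fun p => fderiv ℝ f p (0, 1) :=
    fun hf => (hf.continuous_fderiv one_ne_zero).clm_apply continuous_const
  -- The derivative of `posSq` is the positive part, so the chain rule turns the energy into the
  -- evolution terms of `a` and `b` tested with the same `q`, plus the drift.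
  have hfd : ∀ p, θ p.2 * fderiv ℝ (fun p => posSq (D - L p)) p (0, 1) =
      -(q p * bendDeriv ε η (a p) * fderiv ℝ a p (0, 1) +
        q p * bendDeriv ε η (b p) * fderiv ℝ b p (0, 1) + m * q p) := by
    intro p
    rw [fderiv_posSq_sub hLc, fderiv_level hac hbc]
    simp only [hq]
    ring
  have hbdc : Continuous (bendDeriv ε η) := by unfold bendDeriv; fun_prop
  have iA : Integrable fun p => q p * bendDeriv ε η (a p) * fderiv ℝ a p (0, 1) :=
    ((hqc.mul (hbdc.comp hac.continuous)).mul (hvc hac)).integrable_of_hasCompactSupport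
      hqcs.mul_right.mul_right
  have iB : Integrable fun p => q p * bendDeriv ε η (b p) * fderiv ℝ b p (0, 1) :=
    ((hqc.mul (hbdc.comp hbc.continuous)).mul (hvc hbc)).integrable_of_hasCompactSupport
      hqcs.mul_right.mul_right
  have iq : Integrable q := hqc.integrable_of_hasCompactSupport hqcs
  have hibp : ∫ p, θ p.2 * fderiv ℝ (fun p => posSq (D - L p)) p (0, 1) =
      -∫ p, fderiv ℝ (fun p : Space N × ℝ => θ p.2) p (0, 1) * posSq (D - L p) := by
    refine integral_mul_fderiv_eq_neg_fderiv_mul_of_integrable ?_ ?_ ?_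
      (fun p _ => hθc.differentiable one_ne_zero p) (fun p _ => hgc.differentiable one_ne_zero p)
    · refine ((hvc hθc).mul hgc.continuous).integrable_of_hasCompactSupport
        (hasCompactSupport_of_box (R := R) (α := α) (β := β) fun p hp => ?_)
      refine hbox p (fun h => left_ne_zero_of_mul hp ?_) (hgne p (right_ne_zero_of_mul hp))
      exact (fderiv_comp_snd hθ p).trans (deriv_eq_zero_of_nonneg hθ0 h)
    · simp_rw [hfd]
      exact ((iA.add iB).add (iq.const_mul m)).neg
    · refine (hθc.continuous.mul hgc.continuous).integrable_of_hasCompactSupport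
        (hasCompactSupport_of_box (R := R) (α := α) (β := β) fun p hp => ?_)
      exact hbox p (left_ne_zero_of_mul hp) (hgne p (right_ne_zero_of_mul hp))
  simp_rw [fderiv_comp_snd hθ] at hibp
  rw [← hibp]
  simp_rw [hfd]
  have iAB : Integrable fun p => q p * bendDeriv ε η (a p) * fderiv ℝ a p (0, 1) +
      q p * bendDeriv ε η (b p) * fderiv ℝ b p (0, 1) := iA.add iB
  rw [integral_neg, integral_add iAB (iq.const_mul m), integral_add iA iB,
    integral_const_mul]
  have eA := hA.le_integral_mul_bendDeriv ρ hqc hqcs hq0 hac.continuous ha0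
    (fun p hp p' hd => let h := hs p (hqne p hp).1 (hqne p hp).2 p' hd; ⟨h.1, h.2.1⟩)
    hε hη hεη hM
  have eB := hB.le_integral_mul_bendDeriv ρ hqc hqcs hq0 hbc.continuous hb0
    (fun p hp p' hd => let h := hs p (hqne p hp).1 (hqne p hp).2 p' hd; ⟨h.1, h.2.2⟩)
    hε hη hεη hM
  have hqi : 0 ≤ ∫ p, q p := integral_nonneg hq0
  -- Each of the inequalities for `A` and `B` loses `ε * η * M * ∫ q`; the drift pays for both.
  have hmq := mul_le_mul_of_nonneg_right hm hqi
  rw [← ha] at eA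
  rw [← hb] at eB
  linarith

end Energy

end MinkowskiFlow

/-! ### Convergence of mollifications. -/

namespace MinkowskiFlow

open scoped Convolution Pointwise

section Limit

variable {N : ℕ}

/-- A sequence of bump functions in space-time with supports of size at most `κ` shrinking to a
point. -/
noncomputable def bumpSeq (N : ℕ) {κ : ℝ} (hκ : 0 < κ) (n : ℕ) :
    ContDiffBump (0 : Space N × ℝ) where
  rIn := κ / (n + 1) / 2
  rOut := κ / (n + 1)
  rIn_pos := by positivity
  rIn_lt_rOut := half_lt_self (by positivity)

theorem bumpSeq_rOut_le {κ : ℝ} (hκ : 0 < κ) (n : ℕ) : (bumpSeq N hκ n).rOut ≤ κ :=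
  div_le_self hκ.le (by linarith [n.cast_nonneg (α := ℝ)])

theorem tendsto_bumpSeq_rOut {κ : ℝ} (hκ : 0 < κ) :
    Tendsto (fun n => (bumpSeq N hκ n).rOut) atTop (𝓝 0) := by
  have := (tendsto_one_div_add_atTop_nhds_zero_nat (𝕜 := ℝ)).const_mul κ
  simpa [bumpSeq, div_eq_mul_inv] using this

theorem ae_tendsto_mollify_bumpSeq {κ : ℝ} (hκ : 0 < κ) {A : Space N × ℝ → ℝ}
    (hA : LocallyIntegrable A) :
    ∀ᵐ p, Tendsto (fun n => mollify volume (bumpSeq N hκ n) A p) atTop (𝓝 (A p)) := by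
  refine ContDiffBump.ae_convolution_tendsto_right_of_locallyIntegrable (K := 2)
    (tendsto_bumpSeq_rOut hκ) (Eventually.of_forall fun n => ?_) hA
  simp only [bumpSeq]
  linarith

/-- Mollifications of a boundedly convergent sequence converge almost everywhere along a
subsequence. -/
theorem exists_subseq_ae_tendsto_mollify {κ : ℝ} (hκ : 0 < κ) {q : ℕ → Space N × ℝ → ℝ}
    {f g : Space N × ℝ → ℝ} (hq : ∀ n, AEStronglyMeasurable (q n)) (hg : Integrable g)
    (hqg : ∀ n p, ‖q n p‖ ≤ g p) (hlim : ∀ᵐ p, Tendsto (fun n => q n p) atTop (𝓝 (f p))) :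
    ∃ ns : ℕ → ℕ, StrictMono ns ∧ ∀ᵐ p, Tendsto
      (fun k => mollify volume (bumpSeq N hκ (ns k)) (q (ns k)) p) atTop (𝓝 (f p)) := by
  have hqi : ∀ n, Integrable (q n) := fun n => hg.mono' (hq n) (Eventually.of_forall (hqg n))
  have hfm : AEStronglyMeasurable f := aestronglyMeasurable_of_tendsto_ae atTop hq hlim
  have hfg : ∀ᵐ p, ‖f p‖ ≤ g p := hlim.mono fun p hp =>
    le_of_tendsto hp.norm (Eventually.of_forall fun n => hqg n p)
  have hfi : Integrable f := hg.mono' hfm hfg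
  have hdi : ∀ n, Integrable fun p => |q n p - f p| := fun n => ((hqi n).sub hfi).abs
  have hL1 : Tendsto (fun n => ∫ p, |q n p - f p|) atTop (𝓝 0) := by
    have := tendsto_integral_of_dominated_convergence (fun p => g p + g p)
      (fun n => (hdi n).aestronglyMeasurable) (hg.add hg)
      (fun n => hfg.mono fun p hp => by
        rw [Real.norm_eq_abs, abs_abs]
        have h1 := hqg n p
        rw [Real.norm_eq_abs] at hp h1
        exact (abs_sub _ _).trans (add_le_add h1 hp))
      (hlim.mono fun p hp => (hp.sub_const (f p)).abs)
    simpa using this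
  -- Kernel and function vary together, so differentiation of integrals is not enough. The error
  -- against mollifying the limit is dominated by `w n`, whose `L¹` norm is that of `q n - f` and
  -- tends to zero; this is why a subsequence is needed.
  set w : ℕ → Space N × ℝ → ℝ := fun n =>
    mollify volume (bumpSeq N hκ n) fun p => |q n p - f p| with hw
  have hw0 : ∀ n p, 0 ≤ w n p := fun n => mollify_nonneg _ fun _ => abs_nonneg _
  have hwi : ∀ n, Integrable (w n) := fun n => integrable_mollify _ (hdi n)
  have hwL : Tendsto (fun n => eLpNorm (w n - 0) 1 volume) atTop (𝓝 0) := by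
    have h1 : ∀ n, eLpNorm (w n - 0) 1 volume = ENNReal.ofReal (∫ p, |q n p - f p|) := by
      intro n
      rw [sub_zero, eLpNorm_one_eq_lintegral_enorm, ← integral_mollify (bumpSeq N hκ n) (hdi n),
        ofReal_integral_eq_lintegral_ofReal (hwi n) (Eventually.of_forall (hw0 n))]
      congr 1
      funext p
      exact Real.enorm_of_nonneg (hw0 n p)
    simp_rw [h1]
    simpa using ENNReal.tendsto_ofReal hL1
  obtain ⟨ns, hns, hae⟩ := (tendstoInMeasure_of_tendsto_eLpNorm one_ne_zero
    (fun n => (hwi n).aestronglyMeasurable) aestronglyMeasurable_zero hwL).exists_seq_tendsto_ae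
  refine ⟨ns, hns, ?_⟩
  filter_upwards [hae, ae_tendsto_mollify_bumpSeq hκ hfi.locallyIntegrable] with p h1 h2
  have h3 := h2.comp hns.tendsto_atTop
  have h4 : Tendsto (fun k => mollify volume (bumpSeq N hκ (ns k)) (q (ns k)) p -
      mollify volume (bumpSeq N hκ (ns k)) f p) atTop (𝓝 0) :=
    squeeze_zero_norm (fun k => abs_mollify_sub_le _ (hqi _).locallyIntegrable
      hfi.locallyIntegrable p) h1
  simpa using h4.add h3

/-- Almost everywhere convergence improves to convergence at all points of almost all time slices
for functions which are uniformly Lipschitz in space. -/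
theorem ae_forall_tendsto_of_lipschitz {f : ℕ → Space N × ℝ → ℝ} {g : Space N × ℝ → ℝ} {C : ℝ}
    (hf : ∀ n t x x', |f n (x, t) - f n (x', t)| ≤ C * dist x x')
    (hg : ∀ t x x', |g (x, t) - g (x', t)| ≤ C * dist x x')
    (hlim : ∀ᵐ p, Tendsto (fun n => f n p) atTop (𝓝 (g p))) :
    ∀ᵐ t : ℝ, ∀ x, Tendsto (fun n => f n (x, t)) atTop (𝓝 (g (x, t))) := by
  have h1 : ∀ᵐ p : ℝ × Space N, Tendsto (fun n => f n p.swap) atTop (𝓝 (g p.swap)) :=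
    Measure.measurePreserving_swap.quasiMeasurePreserving.ae hlim
  filter_upwards [Measure.ae_ae_of_ae_prod h1] with t ht x
  have hd : Dense {x | Tendsto (fun n => f n (x, t)) atTop (𝓝 (g (x, t)))} :=
    Measure.dense_of_ae ht
  rw [Metric.tendsto_atTop]
  intro e he
  obtain ⟨x', hx', hxx⟩ := Metric.mem_closure_iff.1 (hd x) (e / (3 * (|C| + 1))) (by positivity)
  obtain ⟨n0, hn0⟩ := Metric.tendsto_atTop.1 hx' (e / 3) (by positivity)
  refine ⟨n0, fun n hn => ?_⟩
  have hC : C * dist x x' < e / 3 := by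
    have h2 : C * dist x x' ≤ |C| * dist x x' :=
      mul_le_mul_of_nonneg_right (le_abs_self C) dist_nonneg
    have h3 : |C| * dist x x' ≤ (|C| + 1) * dist x x' :=
      mul_le_mul_of_nonneg_right (by linarith) dist_nonneg
    have h4 : (|C| + 1) * dist x x' < (|C| + 1) * (e / (3 * (|C| + 1))) :=
      mul_lt_mul_of_pos_left hxx (by positivity)
    have h5 : (|C| + 1) * (e / (3 * (|C| + 1))) = e / 3 := by field_simp
    linarith
  have h6 := abs_le.1 (hf n t x x')
  have h7 := abs_le.1 (hg t x x')
  have h8 := abs_lt.1 (by simpa [Real.dist_eq] using hn0 n hn)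
  rw [Real.dist_eq, abs_lt]
  constructor <;> linarith [h6.1, h6.2, h7.1, h7.2, h8.1, h8.2]

end Limit

end MinkowskiFlow

/-! ### The energy inequality without mollification. -/

namespace MinkowskiFlow

open scoped Convolution Pointwise

section Energy

variable {N : ℕ} {r α β ℓ M : ℝ} {A B : Space N × ℝ → ℝ}
  {z y : Space N × ℝ → FiniteMeasure (pairBall N r)}

/-- The slope of `bend` lies between `0` and `1`: the lift itself is decreasing, so it never
enlarges increments. -/
theorem bend_sub_le {ε η : ℝ} (hε : 0 ≤ ε) (hεη : ε * η ≤ 1) {a b d : ℝ} (ha : 0 ≤ a)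
    (hd : 0 ≤ d) (hab : a - b ≤ d) : bend ε η a - bend ε η b ≤ d := by
  rcases le_total a b with h | h
  · linarith [bend_mono hε hεη ha h]
  · have h1 : posSq (η - a) ≤ posSq (η - b) := posSq_mono (by linarith)
    have h2 := mul_le_mul_of_nonneg_left h1 hε
    unfold bend
    linarith

theorem level_sub_le {ε η m : ℝ} (hε : 0 ≤ ε) (hεη : ε * η ≤ 1) (hA : ∀ p, 0 ≤ A p)
    (hB : ∀ p, 0 ≤ B p) {x x' : Space N} {t d : ℝ} (hd : 0 ≤ d)
    (hAd : A (x, t) - A (x', t) ≤ d) (hBd : B (x, t) - B (x', t) ≤ d) :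
    level ε η m α A B (x, t) - level ε η m α A B (x', t) ≤ 2 * d := by
  have h1 := bend_sub_le hε hεη (hA (x, t)) hd hAd
  have h2 := bend_sub_le hε hεη (hB (x, t)) hd hBd
  unfold level
  linarith

/-- The point is that the spatial Lipschitz constant involves only `θ`; it is therefore uniform
along the mollifications. -/
theorem abs_cutoff_sub_le {ε η m D : ℝ} (hε : 0 ≤ ε) (hεη : ε * η ≤ 1) (hA : ∀ p, 0 ≤ A p)
    (hB : ∀ p, 0 ≤ B p) (hAl : ∀ t x x', A (x, t) - A (x', t) ≤ dist x x')
    (hBl : ∀ t x x', B (x, t) - B (x', t) ≤ dist x x') {θ : ℝ → ℝ} {C : ℝ}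
    (hθ0 : ∀ t, 0 ≤ θ t) (hC : ∀ t, θ t ≤ C) (t : ℝ) (x x' : Space N) :
    |θ t * max (D - level ε η m α A B (x, t)) 0 - θ t * max (D - level ε η m α A B (x', t)) 0| ≤
      2 * C * dist x x' := by
  have h1 := level_sub_le (α := α) (m := m) hε hεη hA hB dist_nonneg (hAl t x x') (hBl t x x')
  have h2 := level_sub_le (α := α) (m := m) hε hεη hA hB dist_nonneg (hAl t x' x) (hBl t x' x)
  rw [dist_comm] at h2
  rw [← mul_sub, abs_mul, abs_of_nonneg (hθ0 t)]
  have h3 : |max (D - level ε η m α A B (x, t)) 0 - max (D - level ε η m α A B (x', t)) 0| ≤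
      2 * dist x x' :=
    (abs_max_sub_max_le_abs _ _ _).trans (abs_le.2 ⟨by linarith, by linarith⟩)
  calc θ t * |max (D - level ε η m α A B (x, t)) 0 - max (D - level ε η m α A B (x', t)) 0|
      ≤ C * (2 * dist x x') := mul_le_mul (hC t) h3 (abs_nonneg _) ((hθ0 t).trans (hC t))
    _ = 2 * C * dist x x' := by ring

theorem level_nonneg {ε η m : ℝ} (hε : 0 ≤ ε) (hm : 0 ≤ m) (hA : ∀ p, 0 ≤ A p)
    (hB : ∀ p, 0 ≤ B p) {p : Space N × ℝ} (hp : α ≤ p.2) : 0 ≤ level ε η m α A B p :=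
  add_nonneg (add_nonneg ((hA p).trans (le_bend hε η _)) ((hB p).trans (le_bend hε η _)))
    (mul_nonneg hm (by linarith))

/-- The energy inequality in the limit of vanishing mollification. -/
theorem IsLocalSupersolution.energy (hr : 0 < r) (hA : IsLocalSupersolution r α β ℓ M A z)
    (hB : IsLocalSupersolution r α β ℓ M B y) {κ : ℝ} (hκ : 0 < κ)
    {θ : ℝ → ℝ} (hθ : ContDiff ℝ 1 θ) (hθ0 : ∀ t, 0 ≤ θ t) (hθc : HasCompactSupport θ)
    {ε η m D R : ℝ}
    (hε : 0 ≤ ε) (hη : 0 ≤ η) (hεη : ε * η ≤ 1) (hM : 0 ≤ M) (hm : 2 * (ε * η * M) ≤ m)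
    (hbox : ∀ ρ : ContDiffBump (0 : Space N × ℝ), ρ.rOut ≤ κ → ∀ p, θ p.2 ≠ 0 →
      level ε η m α (mollify volume ρ A) (mollify volume ρ B) p < D →
      ‖p.1‖ ≤ R ∧ p.2 ∈ Set.Icc α β)
    (hs : ∀ ρ : ContDiffBump (0 : Space N × ℝ), ρ.rOut ≤ κ → ∀ p, θ p.2 ≠ 0 →
      level ε η m α (mollify volume ρ A) (mollify volume ρ B) p < D →
      ∀ p', dist p' p < 2 * ρ.rOut → p'.2 ∈ Set.Icc α β ∧ ℓ ≤ A p' ∧ ℓ ≤ B p') :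
    0 ≤ ∫ p : Space N × ℝ, deriv θ p.2 * posSq (D - level ε η m α A B p) := by
  have hm0 : 0 ≤ m := le_trans (by positivity) hm
  obtain ⟨C, hC⟩ := hθc.exists_bound_of_continuous hθ.continuous
  obtain ⟨C', hC'⟩ := hθc.deriv.exists_bound_of_continuous (hθ.continuous_deriv le_rfl)
  have hCθ : ∀ t, θ t ≤ C := fun t => (le_abs_self _).trans (hC t)
  have hC0 : 0 ≤ C := (hθ0 0).trans (hCθ 0)
  have hC'0 : 0 ≤ C' := (norm_nonneg _).trans (hC' 0)
  let ρ : ℕ → ContDiffBump (0 : Space N × ℝ) := bumpSeq N hκ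
  let a : ℕ → Space N × ℝ → ℝ := fun n => mollify volume (ρ n) A
  let b : ℕ → Space N × ℝ → ℝ := fun n => mollify volume (ρ n) B
  let L : ℕ → Space N × ℝ → ℝ := fun n => level ε η m α (a n) (b n)
  let q : ℕ → Space N × ℝ → ℝ := fun n p => θ p.2 * max (D - L n p) 0
  let qlim : Space N × ℝ → ℝ := fun p => θ p.2 * max (D - level ε η m α A B p) 0
  have hρ : ∀ n, (ρ n).rOut ≤ κ := bumpSeq_rOut_le hκ
  have ha0 : ∀ n p, 0 ≤ a n p := fun n => mollify_nonneg _ hA.nonneg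
  have hb0 : ∀ n p, 0 ≤ b n p := fun n => mollify_nonneg _ hB.nonneg
  have hac : ∀ n, ContDiff ℝ 1 (a n) := fun n =>
    (contDiff_mollify _ hA.locallyIntegrable).of_le (by simp)
  have hbc : ∀ n, ContDiff ℝ 1 (b n) := fun n =>
    (contDiff_mollify _ hB.locallyIntegrable).of_le (by simp)
  have hLc : ∀ n, Continuous (L n) := fun n => (contDiff_level (hac n) (hbc n)).continuous
  have hqc : ∀ n, Continuous (q n) := fun n =>
    (hθ.continuous.comp continuous_snd).mul ((continuous_const.sub (hLc n)).max continuous_const)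
  have hlip : ∀ {A : Space N × ℝ → ℝ}, (∀ t, LipschitzWith 1 fun x => A (x, t)) →
      ∀ t x x', A (x, t) - A (x', t) ≤ dist x x' := fun {A} h t x x' => by
    have := (h t).dist_le_mul x x'
    rw [NNReal.coe_one, one_mul] at this
    exact (le_abs_self _).trans this
  have hmlip : ∀ {A : Space N × ℝ → ℝ}, LocallyIntegrable A →
      (∀ t, LipschitzWith 1 fun x => A (x, t)) →
      ∀ n t x x', mollify volume (ρ n) A (x, t) - mollify volume (ρ n) A (x', t) ≤ dist x x' := by
    intro A hAi hAl n t x x'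
    refine mollify_sub_le _ hAi fun s => ?_
    have h := hlip hAl (t - s.2) (x - s.1) (x' - s.1)
    rw [dist_sub_right] at h
    exact h
  have hqne : ∀ n p, q n p ≠ 0 → θ p.2 ≠ 0 ∧ L n p < D := by
    intro n p hp
    refine ⟨left_ne_zero_of_mul hp, ?_⟩
    by_contra! h
    exact right_ne_zero_of_mul hp (max_eq_right (by linarith))
  have hqbox : ∀ n p, q n p ≠ 0 → ‖p.1‖ ≤ R ∧ p.2 ∈ Set.Icc α β := fun n p hp =>
    hbox (ρ n) (hρ n) p (hqne n p hp).1 (hqne n p hp).2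
  have hq0 : ∀ n p, 0 ≤ q n p := fun n p => mul_nonneg (hθ0 _) (le_max_right _ _)
  have hqb : ∀ n p, q n p ≤ C * |D| := by
    intro n p
    by_cases hp : q n p = 0
    · rw [hp]; positivity
    · have h1 : 0 ≤ L n p := level_nonneg hε hm0 (ha0 n) (hb0 n) (hqbox n p hp).2.1
      refine mul_le_mul (hCθ _) (max_le ?_ (abs_nonneg D)) (le_max_right _ _) hC0
      linarith [le_abs_self D]
  have hqind : ∀ n p, ‖q n p‖ ≤ ({p | ‖p.1‖ ≤ R ∧ p.2 ∈ Set.Icc α β} :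
      Set (Space N × ℝ)).indicator (fun _ => C * |D|) p := by
    intro n p
    by_cases hp : q n p = 0
    · rw [hp, norm_zero]
      exact Set.indicator_nonneg (fun _ _ => by positivity) _
    · rw [Set.indicator_of_mem (by exact hqbox n p hp), Real.norm_of_nonneg (hq0 n p)]
      exact hqb n p
  have hLlim : ∀ᵐ p, Tendsto (fun n => L n p) atTop (𝓝 (level ε η m α A B p)) := by
    filter_upwards [ae_tendsto_mollify_bumpSeq hκ hA.locallyIntegrable,
      ae_tendsto_mollify_bumpSeq hκ hB.locallyIntegrable] with p h1 h2
    have hb := (contDiff_bend ε η).continuous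
    exact (((hb.tendsto _).comp h1).add ((hb.tendsto _).comp h2)).add_const _
  have hqlim : ∀ᵐ p, Tendsto (fun n => q n p) atTop (𝓝 (qlim p)) := by
    filter_upwards [hLlim] with p hp
    exact ((hp.const_sub D).max tendsto_const_nhds).const_mul _
  obtain ⟨ns, hns, hae⟩ := exists_subseq_ae_tendsto_mollify hκ
    (fun n => (hqc n).aestronglyMeasurable) (integrable_indicator_box N R α β (C * |D|)) hqind hqlim
  let f : ℕ → Space N × ℝ → ℝ := fun k => mollify volume (ρ (ns k)) (q (ns k))
  have hqli : ∀ n, LocallyIntegrable (q n) := fun n => (hqc n).locallyIntegrable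
  have hqlip : ∀ n t x x', |q n (x, t) - q n (x', t)| ≤ 2 * C * dist x x' := fun n =>
    abs_cutoff_sub_le hε hεη (ha0 n) (hb0 n) (hmlip hA.locallyIntegrable hA.lipschitz n)
      (hmlip hB.locallyIntegrable hB.lipschitz n) hθ0 hCθ
  have hqllip : ∀ t x x', |qlim (x, t) - qlim (x', t)| ≤ 2 * C * dist x x' :=
    abs_cutoff_sub_le hε hεη hA.nonneg hB.nonneg (hlip hA.lipschitz) (hlip hB.lipschitz) hθ0 hCθ
  have hflip : ∀ k t x x', |f k (x, t) - f k (x', t)| ≤ 2 * C * dist x x' := by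
    have h1 : ∀ k t x x', f k (x, t) - f k (x', t) ≤ 2 * C * dist x x' := fun k t x x' => by
      refine mollify_sub_le _ (hqli _) fun s => ?_
      have h := (le_abs_self _).trans (hqlip (ns k) (t - s.2) (x - s.1) (x' - s.1))
      rw [dist_sub_right] at h
      exact h
    intro k t x x'
    have h2 := h1 k t x' x
    rw [dist_comm] at h2
    exact abs_le.2 ⟨by linarith, h1 k t x x'⟩
  -- The measures `z p` may be singular, so convergence at almost every point in space would not
  -- suffice; the uniform Lipschitz bound upgrades it to every point of almost every slice.
  have hft : ∀ᵐ p : Space N × ℝ, ∀ x, Tendsto (fun k => f k (x, p.2)) atTop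
      (𝓝 (qlim (x, p.2))) :=
    Measure.quasiMeasurePreserving_snd.ae (ae_forall_tendsto_of_lipschitz hflip hqllip hae)
  have hfc : ∀ k, Continuous (f k) := fun k => (contDiff_mollify _ (hqli _)).continuous
  have hfb : ∀ k p, |f k p| ≤ C * |D| := fun k p => by
    rw [abs_of_nonneg (mollify_nonneg _ (hq0 _) p)]
    exact mollify_le_of_le _ (hqli _) fun p' _ => hqb _ p'
  have hfbox : ∀ k p, f k p ≠ 0 → ‖p.1‖ ≤ R + κ ∧ p.2 ∈ Set.Icc α β := by
    intro k p hp
    obtain ⟨p', hp', hne⟩ := exists_ne_zero_of_mollify_ne_zero hp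
    have h1 := hqne _ _ hne
    have h2 := hqbox _ _ hne
    have h3 : dist p p' < (ρ (ns k)).rOut := by rwa [dist_comm, ← Metric.mem_ball]
    refine ⟨?_, (hs _ (hρ _) p' h1.1 h1.2 p (by linarith [(ρ (ns k)).rOut_pos])).1⟩
    have h4 : ‖p.1 - p'.1‖ ≤ κ := by
      rw [← dist_eq_norm]
      exact (le_max_left _ _).trans ((h3.le).trans (hρ _))
    have h5 := norm_add_le (p.1 - p'.1) p'.1
    rw [sub_add_cancel] at h5
    linarith [h2.1]
  have hqlc : ∀ t, Continuous fun x => qlim (x, t) := fun t => by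
    refine (LipschitzWith.of_dist_le_mul (K := ⟨2 * C, by positivity⟩) fun x x' => ?_).continuous
    exact hqllip t x x'
  -- This is the hypothesis of the crosswise comparison, available for the unmollified cutoff only.
  have hanti : ∀ t x x', A (x', t) ≤ A (x, t) → B (x', t) ≤ B (x, t) →
      qlim (x, t) ≤ qlim (x', t) := by
    intro t x x' h1 h2
    refine mul_le_mul_of_nonneg_left (max_le_max_right 0 ?_) (hθ0 t)
    have h3 := bend_mono hε hεη (hA.nonneg _) h1
    have h4 := bend_mono hε hεη (hB.nonneg _) h2
    simp only [level]
    linarith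
  obtain ⟨c, hc, hct⟩ := hA.toIsCalibration.exists_tendsto_nonpos hr hB.toIsCalibration hfc hfb
    hfbox hqlc hanti hft
  have hLHS : Tendsto (fun k => -∫ p : Space N × ℝ, deriv θ p.2 * posSq (D - L (ns k) p)) atTop
      (𝓝 (-∫ p : Space N × ℝ, deriv θ p.2 * posSq (D - level ε η m α A B p))) := by
    refine (tendsto_integral_of_dominated_convergence
      (({p | ‖p.1‖ ≤ R ∧ p.2 ∈ Set.Icc α β} : Set (Space N × ℝ)).indicator
        fun _ => C' * posSq D) (fun k => ?_) (integrable_indicator_box N R α β _) (fun k => ?_)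
      ?_).neg
    · exact (((hθ.continuous_deriv le_rfl).comp continuous_snd).mul (contDiff_posSq.continuous.comp
        (continuous_const.sub (hLc _)))).aestronglyMeasurable
    · refine Eventually.of_forall fun p => ?_
      by_cases hp : deriv θ p.2 * posSq (D - L (ns k) p) = 0
      · rw [hp, norm_zero]
        exact Set.indicator_nonneg (fun _ _ => mul_nonneg hC'0 (posSq_nonneg D)) _
      · have h1 : θ p.2 ≠ 0 := fun h =>
          left_ne_zero_of_mul hp (deriv_eq_zero_of_nonneg hθ0 h)
        have h2 : L (ns k) p < D := by
          by_contra! h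
          exact right_ne_zero_of_mul hp (posSq_eq_zero_iff.2 (by linarith))
        have h3 := hbox (ρ (ns k)) (hρ _) p h1 h2
        have h4 : 0 ≤ L (ns k) p := level_nonneg hε hm0 (ha0 _) (hb0 _) h3.2.1
        rw [Set.indicator_of_mem (by exact h3), norm_mul, Real.norm_of_nonneg (posSq_nonneg _)]
        exact mul_le_mul (hC' _) (posSq_mono (by linarith)) (posSq_nonneg _) hC'0
    · filter_upwards [hLlim] with p hp
      exact (((contDiff_posSq.continuous.tendsto _).comp
        ((hp.comp hns.tendsto_atTop).const_sub D))).const_mul _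
  have hle := le_of_tendsto_of_tendsto' hLHS (hct.const_mul (1 / (2 * r))) fun k =>
    hA.energy_mollify hB (ρ (ns k)) hθ hθ0 hε hη hεη hM hm (hbox _ (hρ _)) (hs _ (hρ _))
  have : 1 / (2 * r) * c ≤ 0 := mul_nonpos_of_nonneg_of_nonpos (by positivity) hc
  linarith

end Energy

end MinkowskiFlow

/-! ### Comparison of two local supersolutions on a time window. -/

namespace MinkowskiFlow

open scoped Convolution Pointwise

section Window

variable {N : ℕ} {r α β ℓ M : ℝ} {A B : Space N × ℝ → ℝ}
  {z y : Space N × ℝ → FiniteMeasure (pairBall N r)}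

/-- A `C¹` cutoff function which is supported in `[s₁, d]` and strictly decreasing on `[s₂, d]`. -/
theorem exists_cutoff {s₁ s₂ d : ℝ} (h12 : s₁ < s₂) :
    ∃ θ : ℝ → ℝ, ContDiff ℝ 1 θ ∧ (∀ t, 0 ≤ θ t) ∧ (∀ t, θ t ≠ 0 → s₁ < t ∧ t < d) ∧
      ∀ t, s₂ < t → deriv θ t = -max (d - t) 0 := by
  refine ⟨fun t => Real.smoothTransition ((t - s₁) / (s₂ - s₁)) * posSq (d - t), ?_, ?_, ?_, ?_⟩
  · exact (Real.smoothTransition.contDiff.comp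
      ((contDiff_id.sub contDiff_const).div_const _)).mul
      (contDiff_posSq.comp (contDiff_const.sub contDiff_id))
  · exact fun t => mul_nonneg (Real.smoothTransition.nonneg _) (posSq_nonneg _)
  · intro t ht
    constructor
    · by_contra! h
      exact left_ne_zero_of_mul ht (Real.smoothTransition.zero_of_nonpos
        (div_nonpos_of_nonpos_of_nonneg (by linarith) (by linarith)))
    · by_contra! h
      exact right_ne_zero_of_mul ht (posSq_eq_zero_iff.2 (by linarith))
  · intro t ht
    have h1 : HasDerivAt (fun t => posSq (d - t)) (max (d - t) 0 * -1) t :=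
      (hasDerivAt_posSq (d - t)).comp t ((hasDerivAt_id t).const_sub d)
    have h2 : (fun t => Real.smoothTransition ((t - s₁) / (s₂ - s₁)) * posSq (d - t)) =ᶠ[𝓝 t]
        fun t => posSq (d - t) := by
      filter_upwards [Ioi_mem_nhds ht] with u hu
      rw [Real.smoothTransition.one_of_one_le, one_mul]
      rw [one_le_div (by linarith)]
      linarith [Set.mem_Ioi.1 hu]
    rw [(h1.congr_of_eventuallyEq h2).deriv]
    ring

/-- By Fubini almost every slice is of full measure, hence dense, and a dense closed set is
everything. -/
theorem ae_forall_of_ae_of_isClosed {P : Space N × ℝ → Prop} (h : ∀ᵐ p, P p)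
    (hP : ∀ t, IsClosed {x | P (x, t)}) : ∀ᵐ t : ℝ, ∀ x, P (x, t) := by
  have h1 : ∀ᵐ p : ℝ × Space N, P p.swap :=
    Measure.measurePreserving_swap.quasiMeasurePreserving.ae h
  filter_upwards [Measure.ae_ae_of_ae_prod h1] with t ht x
  have hd : Dense {x | P (x, t)} := Measure.dense_of_ae ht
  have := hd.closure_eq
  rw [(hP t).closure_eq] at this
  exact this.ge (Set.mem_univ x)

/-- If the perturbed sum of two distance functions is below a level which it exceeds initially, then
both initial distances are bounded from below. -/
theorem lt_of_bend_add_bend_lt {ε η δ D a₀ b₀ a b : ℝ} (hε : 0 ≤ ε)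
    (hδη : 24 * δ ≤ η) (hδ : 32 * δ ≤ ε * η ^ 2) (hδ0 : 0 < δ) (ha : a₀ - 2 * δ ≤ a)
    (hb : b₀ - 2 * δ ≤ b) (hD : D ≤ a₀ + b₀) (h : bend ε η a + bend ε η b < D) : η / 4 < a₀ := by
  by_contra! hle
  have h1 := le_bend hε η b
  have h2 := le_bend hε η a
  rcases le_total (η / 2) a with h3 | h3
  -- Here `bend a ≥ η / 2` while `b ≥ D - η / 4 - 2 * δ`, so the sum is at least `D` already without
  -- the lift.
  · linarith
  -- Here the lift is at least `ε * η ^ 2 / 8 ≥ 4 * δ`, exactly the total loss in passing from `a₀ +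
  -- b₀` to `a + b`.
  · have h4 : (η / 2) ^ 2 / 2 ≤ posSq (η - a) := by
      have h5 : η / 2 ≤ max (η - a) 0 := (by linarith : η / 2 ≤ η - a).trans (le_max_left _ _)
      unfold posSq
      have : (η / 2) ^ 2 ≤ max (η - a) 0 ^ 2 := pow_le_pow_left₀ (by linarith) h5 2
      linarith
    have h6 := mul_le_mul_of_nonneg_left h4 hε
    unfold bend at h
    have h7 := mul_nonneg hε (posSq_nonneg (η - b))
    nlinarith

/-- Two local supersolutions which are initially far apart remain so, up to a slow linear loss. -/
theorem IsLocalSupersolution.ae_le_level (hr : 0 < r)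
    (hA : IsLocalSupersolution r α β ℓ M A z) (hB : IsLocalSupersolution r α β ℓ M B y)
    {a₀ b₀ : Space N → ℝ} (ha₀ : ∀ x x', a₀ x - a₀ x' ≤ dist x x')
    (hb₀ : ∀ x x', b₀ x - b₀ x' ≤ dist x x') {δ ε η m D D' R γ c : ℝ} (hδ0 : 0 < δ) (hδ1 : 2 * δ ≤ 1)
    (hδη : 24 * δ ≤ η) (hδε : 32 * δ ≤ ε * η ^ 2) (hε : 0 ≤ ε) (hεη : ε * η ≤ 1) (hM : 0 ≤ M)
    (hm : 2 * (ε * η * M) ≤ m) (hℓ : ℓ ≤ η / 8) (hDD : D' ≤ D)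
    (hAa : ∀ t ∈ Set.Icc α β, ∀ x, a₀ x - δ ≤ A (x, t))
    (hBb : ∀ t ∈ Set.Icc α β, ∀ x, b₀ x - δ ≤ B (x, t))
    (hab : ∀ x, D ≤ a₀ x + b₀ x) (hR : ∀ x, a₀ x ≤ D + 1 → b₀ x ≤ D + 1 → ‖x‖ ≤ R)
    (hc : α < c) (hγ : γ < β)
    (hinit : ∀ t ∈ Set.Icc α c, ∀ x, D' ≤ A (x, t) + B (x, t)) :
    ∀ᵐ t : ℝ, t ∈ Set.Icc α γ → ∀ x, D' ≤ level ε η m α A B (x, t) := by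
  have hη : 0 ≤ η := by linarith
  have hm0 : 0 ≤ m := le_trans (by positivity) hm
  -- `κ` bounds the mollification radii. Margins of `2 * κ` keep the mollified test functions inside
  -- `[α, β]`, and `κ ≤ δ` makes the loss from moving in space comparable to `δ`.
  obtain ⟨κ, hκ0, hκδ, hκc, hκγ⟩ : ∃ κ, 0 < κ ∧ κ ≤ δ ∧ α + 2 * κ < c ∧ γ < β - 2 * κ := by
    refine ⟨min δ (min ((c - α) / 4) ((β - γ) / 4)), ?_, min_le_left _ _, ?_, ?_⟩
    · exact lt_min hδ0 (lt_min (by linarith) (by linarith))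
    · have := (min_le_right δ (min ((c - α) / 4) ((β - γ) / 4))).trans (min_le_left _ _)
      linarith
    · have := (min_le_right δ (min ((c - α) / 4) ((β - γ) / 4))).trans (min_le_right _ _)
      linarith
  obtain ⟨θ, hθ, hθ0, hθs, hθd⟩ := exists_cutoff (d := β - 2 * κ) hκc
  have hθc : HasCompactSupport θ := HasCompactSupport.intro isCompact_Icc fun t ht => by
    by_contra h
    exact ht ⟨(hθs t h).1.le, (hθs t h).2.le⟩
  have htime : ∀ p p' : Space N × ℝ, θ p.2 ≠ 0 → dist p' p < 2 * κ → p'.2 ∈ Set.Icc α β := by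
    intro p p' hp hd
    have h1 : |p'.2 - p.2| < 2 * κ := by
      rw [← Real.dist_eq]
      exact (le_max_right _ _).trans_lt hd
    have h2 := hθs _ hp
    have h3 := abs_lt.1 h1
    constructor <;> linarith [h2.1, h2.2, h3.1, h3.2]
  have hmoll : ∀ {A : Space N × ℝ → ℝ} {a₀ : Space N → ℝ}, LocallyIntegrable A →
      (∀ x x', a₀ x - a₀ x' ≤ dist x x') → (∀ t ∈ Set.Icc α β, ∀ x, a₀ x - δ ≤ A (x, t)) →
      ∀ ρ : ContDiffBump (0 : Space N × ℝ), ρ.rOut ≤ κ → ∀ p, θ p.2 ≠ 0 →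
        a₀ p.1 - 2 * δ ≤ mollify volume ρ A p := by
    intro A a₀ hAi ha₀ hAa ρ hρ p hp
    refine le_mollify_of_le ρ hAi fun p' hp' => ?_
    have h1 : dist p' p < κ := (Metric.mem_ball.1 hp').trans_le hρ
    have h2 := hAa p'.2 (htime p p' hp (by linarith)) p'.1
    have h3 := ha₀ p.1 p'.1
    have h4 : dist p.1 p'.1 < κ := by
      rw [dist_comm]
      exact (le_max_left _ _).trans_lt h1
    have h5 : A (p'.1, p'.2) = A p' := rfl
    linarith
  -- The numbers: `η / 4 - 2 * κ - δ ≥ η / 4 - 3 * δ ≥ η / 8 ≥ ℓ`.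
  have hlower : ∀ {A : Space N × ℝ → ℝ} {a₀ : Space N → ℝ},
      (∀ x x', a₀ x - a₀ x' ≤ dist x x') → (∀ t ∈ Set.Icc α β, ∀ x, a₀ x - δ ≤ A (x, t)) →
      ∀ p p', θ p.2 ≠ 0 → η / 4 < a₀ p.1 → dist p' p < 2 * κ → ℓ ≤ A p' := by
    intro A a₀ ha₀ hAa p p' hp h1 hd
    have h2 := hAa p'.2 (htime p p' hp hd) p'.1
    have h3 := ha₀ p.1 p'.1
    have h4 : dist p.1 p'.1 < 2 * κ := by
      rw [dist_comm]
      exact (le_max_left _ _).trans_lt hd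
    have h5 : A (p'.1, p'.2) = A p' := rfl
    linarith
  have hbend : ∀ {A B : Space N × ℝ → ℝ} {p : Space N × ℝ}, θ p.2 ≠ 0 →
      level ε η m α A B p < D' → bend ε η (A p) + bend ε η (B p) < D := by
    intro A B p hp h
    have h1 : 0 ≤ m * (p.2 - α) := mul_nonneg hm0 (by linarith [(hθs _ hp).1])
    unfold level at h
    linarith
  have hRbox : ∀ {A B : Space N × ℝ → ℝ} {p : Space N × ℝ}, θ p.2 ≠ 0 →
      level ε η m α A B p < D' → (∀ p, 0 ≤ A p) → (∀ p, 0 ≤ B p) → a₀ p.1 - 2 * δ ≤ A p →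
      b₀ p.1 - 2 * δ ≤ B p → ‖p.1‖ ≤ R ∧ p.2 ∈ Set.Icc α β := by
    intro A B p hp h hA0 hB0 h1 h2
    have h3 := hbend hp h
    have h4 := le_bend hε η (A p)
    have h5 := le_bend hε η (B p)
    have h6 := hA0 p
    have h7 := hB0 p
    exact ⟨hR _ (by linarith) (by linarith), htime p p hp (by simpa using hκ0)⟩
  have henergy := hA.energy hr hB hκ0 hθ hθ0 hθc (D := D') (R := R) hε hη hεη hM hm
    (fun ρ hρ p hp h => hRbox hp h (mollify_nonneg ρ hA.nonneg) (mollify_nonneg ρ hB.nonneg)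
      (hmoll hA.locallyIntegrable ha₀ hAa ρ hρ p hp)
      (hmoll hB.locallyIntegrable hb₀ hBb ρ hρ p hp))
    (fun ρ hρ p hp h p' hd => by
      have h1 := hmoll hA.locallyIntegrable ha₀ hAa ρ hρ p hp
      have h2 := hmoll hB.locallyIntegrable hb₀ hBb ρ hρ p hp
      have h3 := hbend hp h
      have hd' : dist p' p < 2 * κ := by linarith
      exact ⟨htime p p' hp hd',
        hlower ha₀ hAa p p' hp
          (lt_of_bend_add_bend_lt (D := D) hε hδη hδε hδ0 h1 h2 (hab p.1) h3) hd',
        hlower hb₀ hBb p p' hp (lt_of_bend_add_bend_lt (D := D) hε hδη hδε hδ0 h2 h1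
          (by linarith [hab p.1]) (by linarith)) hd'⟩)
  have hearly : ∀ p : Space N × ℝ, p.2 ∈ Set.Icc α c → D' ≤ level ε η m α A B p := by
    intro p hp
    have h1 := hinit p.2 hp p.1
    have h2 := le_bend hε η (A p)
    have h3 := le_bend hε η (B p)
    have h4 : 0 ≤ m * (p.2 - α) := mul_nonneg hm0 (by linarith [hp.1])
    have h5 : A (p.1, p.2) = A p := rfl
    have h6 : B (p.1, p.2) = B p := rfl
    unfold level
    linarith
  -- Up to time `c` the square vanishes by `hearly`, later the cutoff decreases. With `henergy` the
  -- integrand is zero almost everywhere, and where `θ' < 0` this is the claim.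
  have hnonpos : ∀ p : Space N × ℝ, deriv θ p.2 * posSq (D' - level ε η m α A B p) ≤ 0 := by
    intro p
    by_cases h0 : θ p.2 = 0
    · rw [deriv_eq_zero_of_nonneg hθ0 h0, zero_mul]
    rcases le_or_gt p.2 c with h1 | h1
    · rw [posSq_eq_zero_iff.2 (by linarith [hearly p ⟨by linarith [(hθs _ h0).1], h1⟩]), mul_zero]
    · rw [hθd _ h1]
      exact mul_nonpos_of_nonpos_of_nonneg (by linarith [le_max_right (β - 2 * κ - p.2) 0])
        (posSq_nonneg _)
  have hLm : AEStronglyMeasurable (level ε η m α A B) := by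
    have hb := (contDiff_bend ε η).continuous
    exact ((hb.comp_aestronglyMeasurable hA.locallyIntegrable.aestronglyMeasurable).add
      (hb.comp_aestronglyMeasurable hB.locallyIntegrable.aestronglyMeasurable)).add
      (by fun_prop : Continuous fun p : Space N × ℝ => m * (p.2 - α)).aestronglyMeasurable
  obtain ⟨C', hC'⟩ := hθc.deriv.exists_bound_of_continuous (hθ.continuous_deriv le_rfl)
  have hint : Integrable fun p : Space N × ℝ =>
      deriv θ p.2 * posSq (D' - level ε η m α A B p) := by
    refine (integrable_indicator_box N R α β (C' * posSq D')).mono'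
      (((hθ.continuous_deriv le_rfl).comp continuous_snd).aestronglyMeasurable.mul
        ((contDiff_posSq.continuous.comp
          (continuous_const.sub continuous_id)).comp_aestronglyMeasurable hLm))
      (Eventually.of_forall fun p => ?_)
    by_cases hp : deriv θ p.2 * posSq (D' - level ε η m α A B p) = 0
    · rw [hp, norm_zero]
      exact Set.indicator_nonneg
        (fun _ _ => mul_nonneg ((norm_nonneg _).trans (hC' 0)) (posSq_nonneg _)) _
    · have h1 : θ p.2 ≠ 0 := fun h => left_ne_zero_of_mul hp (deriv_eq_zero_of_nonneg hθ0 h)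
      have h2 : level ε η m α A B p < D' := by
        by_contra! h
        exact right_ne_zero_of_mul hp (posSq_eq_zero_iff.2 (by linarith))
      have ht := htime p p h1 (by simpa using hκ0)
      have h3 := hRbox h1 h2 hA.nonneg hB.nonneg
        (by linarith [hAa p.2 ht p.1]) (by linarith [hBb p.2 ht p.1])
      have h4 : 0 ≤ level ε η m α A B p := level_nonneg hε hm0 hA.nonneg hB.nonneg h3.2.1
      rw [Set.indicator_of_mem (by exact h3), norm_mul, Real.norm_of_nonneg (posSq_nonneg _)]
      exact mul_le_mul (hC' _) (posSq_mono (by linarith)) (posSq_nonneg _)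
        ((norm_nonneg _).trans (hC' 0))
  have hzero : ∀ᵐ p : Space N × ℝ, deriv θ p.2 * posSq (D' - level ε η m α A B p) = 0 := by
    have h1 : ∫ p : Space N × ℝ, -(deriv θ p.2 * posSq (D' - level ε η m α A B p)) = 0 := by
      refine le_antisymm ?_ (integral_nonneg fun p => by simpa using hnonpos p)
      rw [integral_neg]
      linarith
    have h2 := (integral_eq_zero_iff_of_nonneg (fun p => by simpa using hnonpos p) hint.neg).1 h1
    filter_upwards [h2] with p hp
    have : -(deriv θ p.2 * posSq (D' - level ε η m α A B p)) = 0 := hp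
    linarith
  have hall : ∀ᵐ p : Space N × ℝ, p.2 ∈ Set.Icc α γ → D' ≤ level ε η m α A B p := by
    filter_upwards [hzero] with p hp ht
    rcases le_or_gt p.2 c with h1 | h1
    · exact hearly p ⟨ht.1, h1⟩
    · rw [hθd _ h1, max_eq_left (by linarith [ht.2])] at hp
      rcases mul_eq_zero.1 hp with h2 | h2
      · linarith [ht.2]
      · linarith [posSq_eq_zero_iff.1 h2]
  have hLcont : ∀ t, Continuous fun x => level ε η m α A B (x, t) := by
    intro t
    have hb := (contDiff_bend ε η).continuous
    exact ((hb.comp (hA.lipschitz t).continuous).add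
      (hb.comp (hB.lipschitz t).continuous)).add (continuous_const (y := m * (t - α)))
  have hfin := ae_forall_of_ae_of_isClosed
    (P := fun p => p.2 ∈ Set.Icc α γ → D' ≤ level ε η m α A B p) hall fun t => by
      by_cases ht : t ∈ Set.Icc α γ
      · simpa [ht] using isClosed_le continuous_const (hLcont t)
      · simp [ht]
  filter_upwards [hfin] with t h ht x using h x ht

end Window

end MinkowskiFlow

/-! ### From Cahn-Hoffman fields to local supersolutions. -/

namespace MinkowskiFlow

section Field

variable {N : ℕ} {r : ℝ} {E : Set (Space N × ℝ)} {T : EReal}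
  {z : Space N × ℝ → FiniteMeasure (pairBall N r)}

theorem measurableSet_cylinder (N : ℕ) (T : EReal) : MeasurableSet (cylinder N T) :=
  ((isOpen_lt continuous_const continuous_snd).inter
    (isOpen_lt (continuous_coe_real_ereal.comp continuous_snd) continuous_const)).measurableSet

theorem timeDist_nonneg (E : Set (Space N × ℝ)) (p : Space N × ℝ) : 0 ≤ timeDist E p :=
  Metric.infDist_nonneg

theorem timeDist_of_mem {p : Space N × ℝ} (hp : p ∈ E) : timeDist E p = 0 :=
  Metric.infDist_zero_of_mem (s := slice E p.2) hp

theorem timeDist_le_add_dist (E : Set (Space N × ℝ)) (t : ℝ) (x x' : Space N) :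
    timeDist E (x, t) ≤ timeDist E (x', t) + dist x x' :=
  Metric.infDist_le_infDist_add_dist

theorem continuous_timeDist_slice (E : Set (Space N × ℝ)) (t : ℝ) :
    Continuous fun x => timeDist E (x, t) :=
  (Metric.continuous_infDist_pt (slice E t) : Continuous fun x => Metric.infDist x (slice E t))

/-- The divergence of a Cahn-Hoffman field is bounded above by `M` on `{d ≥ ℓ}`. -/
def DivLE (E : Set (Space N × ℝ)) (T : EReal) (z : Space N × ℝ → FiniteMeasure (pairBall N r))
    (ℓ M : ℝ) : Prop :=
  ∀ φ : Space N × ℝ → ℝ, Continuous φ → HasCompactSupport φ → tsupport φ ⊆ cylinder N T →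
    (∀ p ∈ tsupport φ, ℓ ≤ timeDist E p) → (∀ p, 0 ≤ φ p) →
    -(1 / (2 * r)) * ∫ p in cylinder N T, pairDiff z φ p ≤ M * ∫ p, φ p

theorem IsCahnHoffmanField.exists_divLE (h : IsCahnHoffmanField E T z) {ℓ : ℝ} (hℓ : 0 < ℓ) :
    ∃ M : ℝ, 0 ≤ M ∧ DivLE E T z ℓ M := by
  obtain ⟨μpos, μneg, hdiv, -, hb⟩ := h.divergence
  obtain ⟨M, g, hg, hgM, heq⟩ := hb ℓ hℓ
  refine ⟨M, M.2, fun φ hφ hφc hφs hφℓ hφ0 => ?_⟩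
  have h1 := hdiv.integral_eq φ hφ hφc hφs
  change _ = -(1 / (2 * r)) * ∫ p in cylinder N T, pairDiff z φ p at h1
  rw [← h1]
  have h2 : 0 ≤ ∫ p, φ p ∂μneg := integral_nonneg hφ0
  set S : Set (Space N × ℝ) := {p ∈ cylinder N T | ℓ ≤ timeDist E p} with hS
  have h3 : ∫ p in S, φ p ∂μpos = ∫ p, φ p ∂μpos :=
    setIntegral_eq_integral_of_forall_compl_eq_zero fun p hp => by
      by_contra hne
      have hm := subset_tsupport φ (Function.mem_support.2 hne)
      exact hp ⟨hφs hm, hφℓ p hm⟩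
  have hi : Integrable φ := hφ.integrable_of_hasCompactSupport hφc
  rw [heq, integral_withDensity_eq_integral_smul hg] at h3
  have h4 : ∫ p in S, g p • φ p ≤ ∫ p in S, (M : ℝ) * φ p := by
    refine integral_mono_of_nonneg (Eventually.of_forall fun p => ?_)
      (hi.restrict.const_mul _) (Eventually.of_forall fun p => ?_)
    · exact mul_nonneg (g p).2 (hφ0 p)
    · exact mul_le_mul_of_nonneg_right (hgM p) (hφ0 p)
  have h5 : ∫ p in S, (M : ℝ) * φ p ≤ ∫ p, (M : ℝ) * φ p :=
    setIntegral_le_integral (hi.const_mul _)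
      (Eventually.of_forall fun p => mul_nonneg M.2 (hφ0 p))
  rw [integral_const_mul] at h4
  rw [integral_const_mul, integral_const_mul] at h5
  linarith

theorem IsCahnHoffmanField.evolution (h : IsCahnHoffmanField E T z) {φ : Space N × ℝ → ℝ}
    (hφ : ContDiff ℝ ∞ φ) (hφc : HasCompactSupport φ) (hφs : tsupport φ ⊆ cylinder N T \ E)
    (hφ0 : ∀ p, 0 ≤ φ p) :
    -(1 / (2 * r)) * ∫ p in cylinder N T, pairDiff z φ p ≤
      -∫ p, timeDist E p * fderiv ℝ φ p (0, 1) := by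
  obtain ⟨μpos, μneg, hdiv, hev, -⟩ := h.divergence
  have h1 := hdiv.integral_eq φ hφ.continuous hφc (hφs.trans Set.sdiff_subset)
  change _ = -(1 / (2 * r)) * ∫ p in cylinder N T, pairDiff z φ p at h1
  rw [← h1]
  refine (hev φ hφ hφc hφs hφ0).trans (le_of_eq ?_)
  have hd : ∀ p : Space N × ℝ, deriv (fun s => φ (p.1, s)) p.2 = fderiv ℝ φ p (0, 1) := by
    intro p
    have h2 : HasFDerivAt φ (fderiv ℝ φ (p.1, p.2)) (p.1, p.2) :=
      (hφ.differentiable (by simp) p).hasFDerivAt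
    have h3 : HasDerivAt (fun s : ℝ => (p.1, s)) ((0 : Space N), (1 : ℝ)) p.2 :=
      (hasDerivAt_const p.2 p.1).prodMk (hasDerivAt_id p.2)
    exact (h2.comp_hasDerivAt p.2 h3).deriv
  simp_rw [hd]
  rw [setIntegral_eq_integral_of_forall_compl_eq_zero fun p hp => ?_]
  have : fderiv ℝ φ p = 0 := fderiv_of_notMem_tsupport ℝ fun hm => hp (hφs hm)
  rw [this]
  simp

theorem setIntegral_pairDiff_eq {φ : Space N × ℝ → ℝ} {α β : ℝ} (hφc : HasCompactSupport φ)
    (hJ : ∀ p ∈ tsupport φ, p.2 ∈ Set.Icc α β)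
    (hsub : (Set.univ ×ˢ Set.Icc α β : Set (Space N × ℝ)) ⊆ cylinder N T) :
    ∫ p in Set.univ ×ˢ Set.Icc α β, pairDiff z φ p = ∫ p in cylinder N T, pairDiff z φ p := by
  obtain ⟨R, hR⟩ := exists_box_of_hasCompactSupport hφc
    fun p hp => hJ p (subset_tsupport φ (Function.mem_support.2 hp))
  refine (setIntegral_eq_of_subset_of_forall_sdiff_eq_zero (measurableSet_cylinder N T) hsub
    fun p hp => pairDiff_eq_zero hR fun h => hp.2 ⟨Set.mem_univ _, h.2⟩).symm

/-- Integrability is given only off `E`. The ball of radius `e / 2` about `x₀` avoids `E` during the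
whole window, so the mean of the distance over it is integrable in time; being `1`-Lipschitz in
space, the distance elsewhere in a bounded region exceeds this mean by at most a constant. -/
theorem integrableOn_timeDist_of_point (h : LocallyIntegrableOn (timeDist E) (cylinder N T \ E))
    (hE : IsClosed E) {α β : ℝ}
    (hsub : (Set.univ ×ˢ Set.Icc α β : Set (Space N × ℝ)) ⊆ cylinder N T) {x₀ : Space N} {e : ℝ}
    (he : 0 < e) (hx₀ : ∀ t ∈ Set.Icc α β, e ≤ timeDist E (x₀, t)) (R : ℝ) :
    IntegrableOn (timeDist E) (Metric.closedBall (0 : Space N) R ×ˢ Set.Icc α β) := by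
  set W : Set (Space N × ℝ) := Set.univ ×ˢ Set.Icc α β with hW
  set b : Set (Space N) := Metric.closedBall x₀ (e / 2) with hb
  have hbc : IsCompact b := isCompact_closedBall _ _
  have hK : IsCompact (Metric.closedBall (0 : Space N) R ×ˢ Set.Icc α β) :=
    (isCompact_closedBall _ _).prod isCompact_Icc
  have hmeas : AEStronglyMeasurable (timeDist E)
      (volume.restrict (Metric.closedBall (0 : Space N) R ×ˢ Set.Icc α β)) := by
    have h1 : AEStronglyMeasurable (timeDist E) (volume.restrict (cylinder N T \ E)) :=
      h.aestronglyMeasurable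
    have h2 : AEStronglyMeasurable (timeDist E) (volume.restrict E) := by
      refine (aestronglyMeasurable_const (b := (0 : ℝ))).congr ?_
      filter_upwards [ae_restrict_mem hE.measurableSet] with p hp
      exact (timeDist_of_mem hp).symm
    refine (aestronglyMeasurable_union_iff.2 ⟨h1, h2⟩).mono_set fun p hp => ?_
    by_cases hpE : p ∈ E
    · exact Or.inr hpE
    · exact Or.inl ⟨hsub ⟨Set.mem_univ _, hp.2⟩, hpE⟩
  have hbint : IntegrableOn (timeDist E) (b ×ˢ Set.Icc α β) := by
    refine h.integrableOn_compact_subset (fun p hp => ⟨hsub ⟨Set.mem_univ _, hp.2⟩, fun hpE => ?_⟩)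
      (hbc.prod isCompact_Icc)
    have h1 := timeDist_le_add_dist E p.2 x₀ p.1
    have h2 : timeDist E (p.1, p.2) = 0 := timeDist_of_mem hpE
    have h3 := hx₀ p.2 hp.2
    have h4 : dist p.1 x₀ ≤ e / 2 := hp.1
    rw [dist_comm] at h4
    linarith
  have hV : 0 < volume.real b :=
    ENNReal.toReal_pos (Metric.measure_closedBall_pos volume x₀ (half_pos he)).ne'
      hbc.measure_lt_top.ne
  have hm : IntegrableOn (fun t => ∫ x in b, timeDist E (x, t)) (Set.Icc α β) := by
    have h1 : Integrable (timeDist E) ((volume.restrict b).prod (volume.restrict (Set.Icc α β))) := by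
      rw [Measure.prod_restrict]
      exact hbint
    exact h1.integral_prod_right
  set C : ℝ := R + ‖x₀‖ + e / 2 with hC
  have hbound : Integrable (fun p : Space N × ℝ =>
      (∫ x in b, timeDist E (x, p.2)) / volume.real b + C)
      (volume.restrict (Metric.closedBall (0 : Space N) R ×ˢ Set.Icc α β)) := by
    have h1 : Integrable (fun t => (∫ x in b, timeDist E (x, t)) / volume.real b + C)
        (volume.restrict (Set.Icc α β)) := (hm.div_const _).add (integrable_const _)
    have : IsFiniteMeasure (volume.restrict (Metric.closedBall (0 : Space N) R)) :=
      ⟨by simpa using (isCompact_closedBall (0 : Space N) R).measure_lt_top⟩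
    have h2 := h1.comp_snd (volume.restrict (Metric.closedBall (0 : Space N) R))
    rw [Measure.prod_restrict] at h2
    exact h2
  refine hbound.mono' hmeas ?_
  filter_upwards [ae_restrict_mem hK.measurableSet] with p hp
  rw [Real.norm_of_nonneg (timeDist_nonneg E p), ← sub_le_iff_le_add, le_div_iff₀ hV]
  have hle : ∀ x ∈ b, timeDist E p - C ≤ timeDist E (x, p.2) := by
    intro x hx
    have h1 := timeDist_le_add_dist E p.2 p.1 x
    have h2 : dist x x₀ ≤ e / 2 := hx
    have h3 : ‖p.1‖ ≤ R := by simpa using hp.1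
    have h4 : dist p.1 x ≤ ‖p.1‖ + ‖x₀‖ + e / 2 := by
      have h5 := dist_triangle p.1 x₀ x
      have h6 : dist p.1 x₀ ≤ ‖p.1‖ + ‖x₀‖ := dist_le_norm_add_norm _ _
      rw [dist_comm x x₀] at h2
      linarith
    have h5 : timeDist E (p.1, p.2) = timeDist E p := rfl
    linarith
  calc (timeDist E p - C) * volume.real b = ∫ _ in b, (timeDist E p - C) := by
        simp [mul_comm]
    _ ≤ ∫ x in b, timeDist E (x, p.2) :=
        setIntegral_mono_on (integrableOn_const hbc.measure_lt_top.ne)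
          ((continuous_timeDist_slice E p.2).continuousOn.integrableOn_compact hbc)
          hbc.measurableSet hle

/-- Cutting off in time gives a function that is locally integrable on all of space-time, as
mollification requires. Test functions live inside the window and do not see the cutoff, and
`pairDiff` shifts in space only. -/
theorem IsCahnHoffmanField.isLocalSupersolution (h : IsCahnHoffmanField E T z) (hE : IsClosed E)
    {α β ℓ M : ℝ} (hsub : (Set.univ ×ˢ Set.Icc α β : Set (Space N × ℝ)) ⊆ cylinder N T)
    (hℓ : 0 < ℓ) (hM : DivLE E T z ℓ M) {x₀ : Space N} {e : ℝ}
    (he : 0 < e) (hx₀ : ∀ t ∈ Set.Icc α β, e ≤ timeDist E (x₀, t)) :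
    IsLocalSupersolution r α β ℓ M ((Set.univ ×ˢ Set.Icc α β).indicator (timeDist E)) z := by
  set W : Set (Space N × ℝ) := Set.univ ×ˢ Set.Icc α β with hW
  have hle : volume.restrict W ≤ volume.restrict (cylinder N T) :=
    Measure.restrict_mono hsub le_rfl
  have hWm : MeasurableSet W := MeasurableSet.univ.prod measurableSet_Icc
  have hind : ∀ (x : Space N) (t : ℝ), t ∈ Set.Icc α β →
      W.indicator (timeDist E) (x, t) = timeDist E (x, t) := fun x t ht =>
    Set.indicator_of_mem (show (x, t) ∈ W from ⟨Set.mem_univ _, ht⟩) _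
  have hind0 : ∀ (x : Space N) (t : ℝ), t ∉ Set.Icc α β →
      W.indicator (timeDist E) (x, t) = 0 := fun x t ht =>
    Set.indicator_of_notMem (fun hm => ht hm.2) _
  have hts : ∀ φ : Space N × ℝ → ℝ,
      (∀ p ∈ tsupport φ, p.2 ∈ Set.Icc α β ∧ ℓ ≤ W.indicator (timeDist E) p) →
      ∀ p ∈ tsupport φ, p ∈ cylinder N T ∧ ℓ ≤ timeDist E p := fun φ hφ p hp => by
    have h1 := hφ p hp
    have h2 := h1.2
    rw [hind p.1 p.2 h1.1] at h2
    exact ⟨hsub ⟨Set.mem_univ _, h1.1⟩, h2⟩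
  refine ⟨⟨fun t => ?_, fun f => ?_, ?_, ?_⟩, ?_, ?_, ?_, ?_⟩
  · by_cases ht : t ∈ Set.Icc α β
    · simp_rw [fun x => hind x t ht]
      exact Metric.lipschitz_infDist_pt (slice E t)
    · simp_rw [fun x => hind0 x t ht]
      exact LipschitzWith.const' 0
  · exact (h.memLinftyWeak.weakly_measurable f).mono_measure hle
  · filter_upwards [ae_mono hle h.mass_le_one] with p hp
    exact_mod_cast hp
  · filter_upwards [ae_mono hle h.calibration, ae_restrict_mem hWm] with p hp hpW
    have h1 : ∀ x, W.indicator (timeDist E) (x, p.2) = timeDist E (x, p.2) := fun x =>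
      hind x p.2 hpW.2
    unfold pairDiff
    simp_rw [h1]
    exact hp
  · exact fun p => Set.indicator_nonneg (fun p _ => timeDist_nonneg E p) p
  · rw [locallyIntegrable_iff]
    intro K hK
    obtain ⟨R, hR⟩ := hK.isBounded.exists_norm_le
    have h1 := integrableOn_timeDist_of_point h.locallyIntegrable hE hsub he hx₀ R
    rw [IntegrableOn, integrable_indicator_iff hWm, IntegrableOn, Measure.restrict_restrict hWm]
    refine h1.mono_set fun p hp => ⟨?_, hp.1.2⟩
    simpa using (norm_fst_le p).trans (hR p hp.2)
  · intro φ hφ hφc hφs hφ0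
    have h1 := hts φ hφs
    rw [setIntegral_pairDiff_eq hφc (fun p hp => (hφs p hp).1) hsub]
    refine (h.evolution hφ hφc (fun p hp => ⟨(h1 p hp).1, fun hpE => ?_⟩) hφ0).trans (le_of_eq ?_)
    · have := (h1 p hp).2
      rw [timeDist_of_mem hpE] at this
      linarith
    · congr 2
      funext p
      by_cases hp : p ∈ tsupport φ
      · rw [show W.indicator (timeDist E) p = timeDist E p from hind p.1 p.2 (hφs p hp).1]
      · rw [fderiv_of_notMem_tsupport ℝ hp]
        simp
  · intro φ hφ hφc hφs hφ0
    have h1 := hts φ hφs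
    rw [setIntegral_pairDiff_eq hφc (fun p hp => (hφs p hp).1) hsub]
    exact hM φ hφ.continuous hφc (fun p hp => (h1 p hp).1) (fun p hp => (h1 p hp).2) hφ0

end Field

end MinkowskiFlow

/-! ### Slices of weak superflows. -/

namespace MinkowskiFlow

section Superflow

variable {N : ℕ} {r : ℝ} {E F : Set (Space N × ℝ)} {E₀ F₀ : Set (Space N)}

theorem exists_seq_left {a t : ℝ} {Q : ℝ → Prop} (hQ : ∀ b, a ≤ b → b < t → ∃ s, b < s ∧ s < t ∧ Q s)
    (hat : a < t) : ∃ s : ℕ → ℝ, (∀ n, a < s n ∧ s n < t ∧ Q (s n)) ∧ Tendsto s atTop (𝓝 t) := by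
  have hpos : ∀ n : ℕ, (0 : ℝ) < (t - a) / (n + 1) := fun n =>
    div_pos (by linarith) (by positivity)
  have hle : ∀ n : ℕ, (t - a) / ((n : ℝ) + 1) ≤ t - a := fun n =>
    div_le_self (by linarith) (by linarith [n.cast_nonneg (α := ℝ)])
  choose s hs using fun n : ℕ => hQ (t - (t - a) / (n + 1)) (by linarith [hle n])
    (by linarith [hpos n])
  refine ⟨s, fun n => ⟨by linarith [(hs n).1, hle n], (hs n).2.1, (hs n).2.2⟩, ?_⟩
  have h1 : Tendsto (fun n : ℕ => t - (t - a) / ((n : ℝ) + 1)) atTop (𝓝 t) := by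
    have := ((tendsto_one_div_add_atTop_nhds_zero_nat (𝕜 := ℝ)).const_mul (t - a)).const_sub t
    simpa [div_eq_mul_inv] using this
  exact tendsto_of_tendsto_of_tendsto_of_le_of_le h1 tendsto_const_nhds
    (fun n => (hs n).1.le) (fun n => (hs n).2.1.le)

/-- A thickening of the empty set is empty, which propagates emptiness to the right; a point of a
slice is a limit of points of earlier slices, which propagates it to left limits. -/
theorem IsWeakSuperflow.slice_eq_empty_of_le (h : IsWeakSuperflow r E₀ E) {t : ℝ} (ht : 0 ≤ t)
    (he : slice E t = ∅) : ∀ s, t ≤ s → slice E s = ∅ := by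
  refine real_induction_Ici he (fun s hs hlt => ?_) (fun s hs hse => ?_)
  · obtain ⟨v, hv, hvl⟩ := exists_seq_left (a := t) (t := s) (Q := fun _ => True)
      (fun b _ hb => ⟨(b + s) / 2, by linarith, by linarith, trivial⟩) hs
    rw [Set.eq_empty_iff_forall_notMem]
    intro x hx
    obtain ⟨w, hw, -⟩ := (h.left_continuous s (by linarith) v
      (fun n => ⟨by linarith [(hv n).1], (hv n).2.1⟩) hvl).2 x hx
    have := hw 0
    simp only at this
    rw [hlt (v 0) (hv 0).1.le (hv 0).2.1] at this
    exact this
  · obtain ⟨τ, hτ, hsub⟩ := h.right_control s (by linarith) 1 one_pos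
    refine ⟨τ, hτ, fun u hu => ?_⟩
    have := hsub u hu
    rw [hse, Metric.thickening_empty] at this
    exact Set.subset_empty_iff.1 this

theorem IsWeakSuperflow.slice_nonempty (h : IsWeakSuperflow r E₀ E) {t : ℝ} (ht : 0 < t)
    (htT : (t : EReal) < extinctionTime E) : (slice E t).Nonempty := by
  rw [Set.nonempty_iff_ne_empty]
  intro he
  have : extinctionTime E ≤ t := iInf₂_le t ⟨ht, h.slice_eq_empty_of_le ht.le he⟩
  exact absurd htT (not_lt.2 this)

theorem slice_eq_empty_of_extinctionTime_lt {t : ℝ} (h : extinctionTime E < t) :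
    slice E t = ∅ := by
  obtain ⟨s, hs⟩ := iInf_lt_iff.1 h
  obtain ⟨hs', hst⟩ := iInf_lt_iff.1 hs
  exact hs'.2 t (EReal.coe_le_coe_iff.1 hst.le)

/-- Turns the one-sided control of slices into a lower bound for distances. Nonemptiness matters
because `Metric.infDist` to the empty set is zero. -/
theorem infDist_sub_le_of_subset_thickening {S S' : Set (Space N)} {δ : ℝ} (hne : S'.Nonempty)
    (h : S' ⊆ Metric.thickening δ S) (x : Space N) :
    Metric.infDist x S - δ ≤ Metric.infDist x S' := by
  rw [Metric.le_infDist hne]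
  intro y hy
  obtain ⟨y', hy', hd⟩ := Metric.mem_thickening_iff.1 (h hy)
  have h1 := Metric.infDist_le_dist_of_mem (x := x) hy'
  have h2 := dist_triangle x y y'
  linarith

theorem le_infDist_add_infDist {S S' : Set (Space N)} {D : ℝ} (hS : S.Nonempty) (hS' : S'.Nonempty)
    (h : ∀ x ∈ S, ∀ y ∈ S', D ≤ dist x y) (x : Space N) :
    D ≤ Metric.infDist x S + Metric.infDist x S' := by
  have h1 : D - Metric.infDist x S ≤ Metric.infDist x S' := by
    rw [Metric.le_infDist hS']
    intro y hy
    have h2 : D - dist x y ≤ Metric.infDist x S := by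
      rw [Metric.le_infDist hS]
      intro y' hy'
      have h3 := h y' hy' y hy
      have h4 := dist_triangle y' x y
      rw [dist_comm y' x] at h4
      linarith
    linarith
  linarith

theorem le_dist_of_tendsto_left (hE : IsWeakSuperflow r E₀ E) (hF : IsWeakSuperflow r F₀ F)
    {t D : ℝ} (ht : 0 < t) {s : ℕ → ℝ} (hs : ∀ n, 0 ≤ s n ∧ s n < t)
    (hst : Tendsto s atTop (𝓝 t))
    (h : ∀ n, ∀ x ∈ slice E (s n), ∀ y ∈ slice F (s n), D ≤ dist x y) :
    ∀ x ∈ slice E t, ∀ y ∈ slice F t, D ≤ dist x y := by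
  intro x hx y hy
  obtain ⟨a, ha, hax⟩ := (hE.left_continuous t ht s hs hst).2 x hx
  obtain ⟨b, hb, hby⟩ := (hF.left_continuous t ht s hs hst).2 y hy
  exact ge_of_tendsto (hax.dist hby) (Eventually.of_forall fun n => h n _ (ha n) _ (hb n))

theorem DivLE.mono {T : EReal} {z : Space N × ℝ → FiniteMeasure (pairBall N r)} {ℓ M M' : ℝ}
    (h : DivLE E T z ℓ M) (hM : M ≤ M') : DivLE E T z ℓ M' := fun φ h1 h2 h3 h4 h5 =>
  (h φ h1 h2 h3 h4 h5).trans (mul_le_mul_of_nonneg_right hM (integral_nonneg h5))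

theorem exists_norm_le_of_isBounded {S : Set (Space N)} (hS : S.Nonempty)
    (hb : Bornology.IsBounded S) (D : ℝ) : ∃ R, ∀ x, Metric.infDist x S ≤ D → ‖x‖ ≤ R := by
  obtain ⟨R, hR⟩ := hb.exists_norm_le
  refine ⟨R + (D + 1), fun x hx => ?_⟩
  obtain ⟨y, hy, hd⟩ := (Metric.infDist_lt_iff hS).1 (lt_of_le_of_lt hx (lt_add_one D))
  have h1 : ‖x‖ ≤ ‖y‖ + ‖x - y‖ := by
    have := norm_add_le y (x - y)
    rwa [add_sub_cancel] at this
  rw [← dist_eq_norm] at h1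
  linarith [hR y hy]

theorem not_isBounded_univ (hN : 1 ≤ N) : ¬ Bornology.IsBounded (Set.univ : Set (Space N)) := by
  have : NeZero N := ⟨by omega⟩
  exact NormedSpace.unbounded_univ ℝ (Space N)

/-- Disjoint sets cannot both have bounded complement in an unbounded space. One bounded slice
suffices to give the test functions compact support. -/
theorem isBounded_or_isBounded (hN : 1 ≤ N) (hE : IsWeakSuperflow r E₀ E)
    (hF : IsWeakSuperflow r F₀ F) {t : ℝ} (ht : 0 ≤ t)
    (hd : ∀ x ∈ slice E t, x ∉ slice F t) :
    Bornology.IsBounded (slice E t) ∨ Bornology.IsBounded (slice F t) := by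
  rcases hE.bounded with h | h
  · exact Or.inl (h t ht)
  rcases hF.bounded with h' | h'
  · exact Or.inr (h' t ht)
  refine absurd (((h t ht).union (h' t ht)).subset fun x _ => ?_) (not_isBounded_univ hN)
  by_cases hx : x ∈ slice E t
  · exact Or.inr (hd x hx)
  · exact Or.inl hx

/-- A lower bound for the perturbed sum of the distance functions bounds the distance of the two
slices. -/
theorem le_dist_of_le_level {ε η m α t D d : ℝ} (hε : 0 ≤ ε) (hεη : ε * η ≤ 1)
    {A B : Space N × ℝ → ℝ} {x y : Space N}
    (hA : ∀ w, 0 ≤ A (w, t)) (hB : ∀ w, 0 ≤ B (w, t))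
    (hAx : ∀ w, A (w, t) ≤ dist w x) (hBy : ∀ w, B (w, t) ≤ dist w y) (hd : dist x y = d)
    (hη : 2 * η ≤ d) (h : ∀ w, D ≤ level ε η m α A B (w, t)) : D - m * (t - α) ≤ d := by
  -- At the midpoint both distances are at most `d / 2`, and `η ≤ d / 2` makes `bend` the identity
  -- there, so the lift costs nothing.
  have h1 := h (midpoint ℝ x y)
  have h2 : A (midpoint ℝ x y, t) ≤ d / 2 := by
    refine (hAx _).trans (le_of_eq ?_)
    rw [dist_midpoint_left, hd]
    simp [div_eq_inv_mul]
  have h3 : B (midpoint ℝ x y, t) ≤ d / 2 := by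
    refine (hBy _).trans (le_of_eq ?_)
    rw [dist_midpoint_right, hd]
    simp [div_eq_inv_mul]
  have h4 := bend_mono hε hεη (hA _) h2
  have h5 := bend_mono hε hεη (hB _) h3
  have h6 : bend ε η (d / 2) = d / 2 := bend_of_le (by linarith)
  rw [h6] at h4 h5
  unfold level at h1
  simp only at h1
  linarith

end Superflow

end MinkowskiFlow

/-! ### Comparison of weak superflows. -/

namespace MinkowskiFlow

section Comparison

variable {N : ℕ} {r : ℝ} {E F : Set (Space N × ℝ)} {E₀ F₀ : Set (Space N)}

theorem exists_gt_of_coe_lt {a : ℝ} {T : EReal} (h : (a : EReal) < T) :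
    ∃ b : ℝ, a < b ∧ ∀ s : ℝ, s < b → (s : EReal) < T := by
  obtain ⟨b, h1, h2⟩ := EReal.lt_iff_exists_real_btwn.1 h
  exact ⟨b, EReal.coe_lt_coe_iff.1 h1, fun s hs => (EReal.coe_lt_coe_iff.2 hs).trans h2⟩

theorem exists_Ioo_of_ae {Q : ℝ → Prop} {a b : ℝ} (hab : a < b)
    (h : ∀ᵐ t : ℝ, t ∈ Set.Icc a b → Q t) : ∃ t, a < t ∧ t < b ∧ Q t := by
  have hd : Dense {t : ℝ | t ∈ Set.Icc a b → Q t} := Measure.dense_of_ae h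
  obtain ⟨t, ht, hQ⟩ := hd.exists_mem_open isOpen_Ioo (Set.nonempty_Ioo.2 hab)
  exact ⟨t, hQ.1, hQ.2, ht ⟨hQ.1.le, hQ.2.le⟩⟩

/-- On a short time interval the distance of two weak superflows decreases at most linearly, with
arbitrarily small slope. -/
theorem exists_forall_le_dist (hN : 1 ≤ N) (hr : 0 < r) (hE : IsWeakSuperflow r E₀ E)
    (hF : IsWeakSuperflow r F₀ F) {z y : Space N × ℝ → FiniteMeasure (pairBall N r)}
    (hz : IsCahnHoffmanField E (extinctionTime E) z)
    (hy : IsCahnHoffmanField F (extinctionTime F) y) {η ε M m δ D t₀ : ℝ}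
    (hη : 0 < η) (hε : 0 ≤ ε) (hεη : ε * η ≤ 1) (hM : 0 ≤ M)
    (hME : DivLE E (extinctionTime E) z (η / 8) M) (hMF : DivLE F (extinctionTime F) y (η / 8) M)
    (hm : 2 * (ε * η * M) ≤ m) (hδ0 : 0 < δ) (hδ1 : 2 * δ ≤ 1) (hδη : 24 * δ ≤ η)
    (hδε : 32 * δ ≤ ε * η ^ 2) (ht₀ : 0 ≤ t₀) (hDη : 4 * η ≤ D)
    (hD : ∀ x ∈ slice E t₀, ∀ x' ∈ slice F t₀, D ≤ dist x x')
    (hTE : (t₀ : EReal) < extinctionTime E) (hTF : (t₀ : EReal) < extinctionTime F)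
    (hEne : (slice E t₀).Nonempty) (hFne : (slice F t₀).Nonempty) :
    ∃ τ, 0 < τ ∧ ∀ s ∈ Set.Ioo t₀ (t₀ + τ), ∀ x ∈ slice E s, ∀ x' ∈ slice F s,
      D - m * (s - t₀) ≤ dist x x' := by
  have hm0 : 0 ≤ m := le_trans (by positivity) hm
  obtain ⟨bE, hbE, hbE'⟩ := exists_gt_of_coe_lt hTE
  obtain ⟨bF, hbF, hbF'⟩ := exists_gt_of_coe_lt hTF
  obtain ⟨τE, hτE, hcE⟩ := hE.right_control t₀ ht₀ δ hδ0
  obtain ⟨τF, hτF, hcF⟩ := hF.right_control t₀ ht₀ δ hδ0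
  obtain ⟨τ, hτ0, h1, h2, h3, h4⟩ : ∃ τ, 0 < τ ∧ t₀ + τ ≤ bE ∧ t₀ + τ ≤ bF ∧ τ ≤ τE ∧ τ ≤ τF := by
    refine ⟨min (min (bE - t₀) (bF - t₀)) (min τE τF), ?_, ?_, ?_, ?_, ?_⟩
    · exact lt_min (lt_min (by linarith) (by linarith)) (lt_min hτE hτF)
    · linarith [(min_le_left (min (bE - t₀) (bF - t₀)) (min τE τF)).trans (min_le_left _ _)]
    · linarith [(min_le_left (min (bE - t₀) (bF - t₀)) (min τE τF)).trans (min_le_right _ _)]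
    · exact (min_le_right _ _).trans (min_le_left _ _)
    · exact (min_le_right _ _).trans (min_le_right _ _)
  refine ⟨τ, hτ0, fun s hs => ?_⟩
  set a₀ : Space N → ℝ := fun x => Metric.infDist x (slice E t₀) with ha₀
  set b₀ : Space N → ℝ := fun x => Metric.infDist x (slice F t₀) with hb₀
  have hneE : ∀ t, t₀ < t → t < t₀ + τ → (slice E t).Nonempty := fun t h5 h6 =>
    hE.slice_nonempty (by linarith) (hbE' t (by linarith))
  have hneF : ∀ t, t₀ < t → t < t₀ + τ → (slice F t).Nonempty := fun t h5 h6 =>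
    hF.slice_nonempty (by linarith) (hbF' t (by linarith))
  have hlowE : ∀ t, t₀ < t → t < t₀ + τ → ∀ x, a₀ x - δ ≤ timeDist E (x, t) := fun t h5 h6 x =>
    infDist_sub_le_of_subset_thickening (hneE t h5 h6) (hcE t ⟨h5, by linarith⟩) x
  have hlowF : ∀ t, t₀ < t → t < t₀ + τ → ∀ x, b₀ x - δ ≤ timeDist F (x, t) := fun t h5 h6 x =>
    infDist_sub_le_of_subset_thickening (hneF t h5 h6) (hcF t ⟨h5, by linarith⟩) x
  have hab : ∀ x, D ≤ a₀ x + b₀ x := le_infDist_add_infDist hEne hFne hD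
  have hlip : ∀ (S : Set (Space N)) x x', Metric.infDist x S - Metric.infDist x' S ≤ dist x x' :=
    fun S x x' => by linarith [Metric.infDist_le_infDist_add_dist (s := S) (x := x) (y := x')]
  obtain ⟨R, hR⟩ : ∃ R, ∀ x, a₀ x ≤ D + 1 → b₀ x ≤ D + 1 → ‖x‖ ≤ R := by
    have hdisj : ∀ x ∈ slice E t₀, x ∉ slice F t₀ := fun x hx hx' => by
      have := hD x hx x hx'
      rw [dist_self] at this
      linarith
    rcases isBounded_or_isBounded hN hE hF ht₀ hdisj with hb | hb
    · obtain ⟨R, hR⟩ := exists_norm_le_of_isBounded hEne hb (D + 1)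
      exact ⟨R, fun x h _ => hR x h⟩
    · obtain ⟨R, hR⟩ := exists_norm_le_of_isBounded hFne hb (D + 1)
      exact ⟨R, fun x _ h => hR x h⟩
  -- Just after `t₀` the slices are controlled only up to an arbitrarily small thickening, so the
  -- initial lower bound holds for each `D' < D`. The interval length `τ` was fixed beforehand and
  -- does not depend on `D'`.
  suffices hmain : ∀ D' < D, ∀ x ∈ slice E s, ∀ x' ∈ slice F s, D' - m * (s - t₀) ≤ dist x x' by
    intro x hx x' hx'
    refine le_of_forall_lt fun w hw => ?_
    have := hmain ((w + m * (s - t₀) + D) / 2) (by linarith) x hx x' hx'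
    linarith
  intro D' hD'
  obtain ⟨σE, hσE, hdE⟩ := hE.right_control t₀ ht₀ ((D - D') / 2) (by linarith)
  obtain ⟨σF, hσF, hdF⟩ := hF.right_control t₀ ht₀ ((D - D') / 2) (by linarith)
  obtain ⟨u, hu0, hus, huE, huF⟩ : ∃ u, t₀ < u ∧ u ≤ s ∧ u ≤ t₀ + σE ∧ u ≤ t₀ + σF :=
    ⟨min s (min (t₀ + σE) (t₀ + σF)), lt_min hs.1 (lt_min (by linarith) (by linarith)),
      min_le_left _ _, (min_le_right _ _).trans (min_le_left _ _),
      (min_le_right _ _).trans (min_le_right _ _)⟩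
  -- The window starts strictly after `t₀`, since the control concerns later times and the field
  -- lives on positive times.
  obtain ⟨α, hα0, hαu⟩ := exists_between hu0
  obtain ⟨c, hαc, hcu⟩ := exists_between hαu
  have hIcc : ∀ t ∈ Set.Icc α s, t₀ < t ∧ t < t₀ + τ := fun t ht =>
    ⟨hα0.trans_le ht.1, ht.2.trans_lt hs.2⟩
  have hsubE : (Set.univ ×ˢ Set.Icc α s : Set (Space N × ℝ)) ⊆ cylinder N (extinctionTime E) :=
    fun p hp => ⟨by linarith [(hIcc p.2 hp.2).1], hbE' _ (by linarith [(hIcc p.2 hp.2).2])⟩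
  have hsubF : (Set.univ ×ˢ Set.Icc α s : Set (Space N × ℝ)) ⊆ cylinder N (extinctionTime F) :=
    fun p hp => ⟨by linarith [(hIcc p.2 hp.2).1], hbF' _ (by linarith [(hIcc p.2 hp.2).2])⟩
  obtain ⟨xE, hxE⟩ := hEne
  obtain ⟨xF, hxF⟩ := hFne
  have hxE0 : a₀ xE = 0 := Metric.infDist_zero_of_mem hxE
  have hxF0 : b₀ xF = 0 := Metric.infDist_zero_of_mem hxF
  have hA := hz.isLocalSupersolution hE.isClosed hsubE (by positivity) hME
    -- A point of `F(t₀)` is at distance at least `D` from `E(t₀)`, hence stays away from `E` during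
    -- the window; it anchors the local integrability.
    (x₀ := xF) (e := D - δ) (by linarith) fun t ht => by
      linarith [hlowE t (hIcc t ht).1 (hIcc t ht).2 xF, hab xF]
  have hB := hy.isLocalSupersolution hF.isClosed hsubF (by positivity) hMF
    (x₀ := xE) (e := D - δ) (by linarith) fun t ht => by
      linarith [hlowF t (hIcc t ht).1 (hIcc t ht).2 xE, hab xE]
  set A := (Set.univ ×ˢ Set.Icc α s : Set (Space N × ℝ)).indicator (timeDist E) with hAdef
  set B := (Set.univ ×ˢ Set.Icc α s : Set (Space N × ℝ)).indicator (timeDist F) with hBdef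
  have hAt : ∀ t ∈ Set.Icc α s, ∀ x, A (x, t) = timeDist E (x, t) := fun t ht x =>
    Set.indicator_of_mem (show (x, t) ∈ (Set.univ ×ˢ Set.Icc α s : Set (Space N × ℝ)) from
      ⟨Set.mem_univ _, ht⟩) _
  have hBt : ∀ t ∈ Set.Icc α s, ∀ x, B (x, t) = timeDist F (x, t) := fun t ht x =>
    Set.indicator_of_mem (show (x, t) ∈ (Set.univ ×ˢ Set.Icc α s : Set (Space N × ℝ)) from
      ⟨Set.mem_univ _, ht⟩) _
  have hlevel : ∀ γ < s, ∀ᵐ t : ℝ, t ∈ Set.Icc α γ → ∀ x, D' ≤ level ε η m α A B (x, t) := by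
    intro γ hγ
    refine hA.ae_le_level hr hB (hlip (slice E t₀)) (hlip (slice F t₀)) hδ0 hδ1 hδη hδε hε hεη hM
      hm le_rfl hD'.le (fun t ht x => ?_) (fun t ht x => ?_) hab hR hαc hγ (fun t ht x => ?_)
    · rw [hAt t ht]
      exact hlowE t (hIcc t ht).1 (hIcc t ht).2 x
    · rw [hBt t ht]
      exact hlowF t (hIcc t ht).1 (hIcc t ht).2 x
    · have ht' : t ∈ Set.Icc α s := ⟨ht.1, by linarith [ht.2]⟩
      have h5 := hIcc t ht'
      have h6 : a₀ x - (D - D') / 2 ≤ timeDist E (x, t) :=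
        infDist_sub_le_of_subset_thickening (hneE t h5.1 h5.2)
          (hdE t ⟨h5.1, by linarith [ht.2]⟩) x
      have h7 : b₀ x - (D - D') / 2 ≤ timeDist F (x, t) :=
        infDist_sub_le_of_subset_thickening (hneF t h5.1 h5.2)
          (hdF t ⟨h5.1, by linarith [ht.2]⟩) x
      rw [hAt t ht', hBt t ht']
      linarith [hab x]
  -- The level bound holds at almost every time before `s`; good times increasing to `s` and left
  -- continuity of the slices give time `s` itself.
  obtain ⟨v, hv, hvs⟩ := exists_seq_left (a := α) (t := s)
    (Q := fun t => ∀ x, D' ≤ level ε η m α A B (x, t)) (fun b hb hbs => by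
      obtain ⟨t, ht1, ht2, ht3⟩ := exists_Ioo_of_ae (a := b) (b := (b + s) / 2) (by linarith)
        ((hlevel ((b + s) / 2) (by linarith)).mono fun t h ht => h ⟨hb.trans ht.1, ht.2⟩)
      exact ⟨t, ht1, by linarith, ht3⟩) (by linarith)
  refine le_dist_of_tendsto_left hE hF (by linarith [hs.1])
    (fun n => ⟨by linarith [(hv n).1], (hv n).2.1⟩) hvs fun n x hx x' hx' => ?_
  have hvI : v n ∈ Set.Icc α s := ⟨(hv n).1.le, (hv n).2.1.le⟩
  have hw := hIcc _ hvI
  obtain ⟨w, hw1, hw2⟩ := Metric.mem_thickening_iff.1 (hcE (v n) ⟨hw.1, by linarith⟩ hx)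
  obtain ⟨w', hw1', hw2'⟩ := Metric.mem_thickening_iff.1 (hcF (v n) ⟨hw.1, by linarith⟩ hx')
  -- A crude bound from the thickenings; with `4 * η ≤ D` it ensures that the two points are at
  -- least `2 * η` apart, as the midpoint argument requires.
  have h5 : D ≤ dist x x' + 2 * δ := by
    have h6 := hD w hw1 w' hw1'
    have h7 := dist_triangle4 w x x' w'
    rw [dist_comm w x] at h7
    linarith
  have h8 := le_dist_of_le_level hε hεη (fun _ => hA.nonneg _) (fun _ => hB.nonneg _)
    (fun w => by rw [hAt _ hvI]; exact Metric.infDist_le_dist_of_mem hx)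
    (fun w => by rw [hBt _ hvI]; exact Metric.infDist_le_dist_of_mem hx') rfl
    (by linarith) (hv n).2.2
  have h9 : m * (v n - α) ≤ m * (s - t₀) :=
    mul_le_mul_of_nonneg_left (by linarith [(hv n).2.1]) hm0
  linarith

/-- Weak superflows with initial data at positive distance remain disjoint. -/
theorem IsWeakSuperflow.disjoint (hN : 1 ≤ N) (hr : 0 < r) (hE : IsWeakSuperflow r E₀ E)
    (hF : IsWeakSuperflow r F₀ F) {Δ : ℝ} (hΔ : 0 < Δ) (hd : ∀ x ∈ E₀, ∀ y ∈ F₀, Δ ≤ dist x y)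
    {t : ℝ} (ht : 0 ≤ t) {x : Space N} (hx : x ∈ slice E t) : x ∉ slice F t := by
  obtain ⟨z, hz⟩ := hE.exists_field
  obtain ⟨y, hy⟩ := hF.exists_field
  -- The distance will be kept above `Δ / 2 = 4 * η` up to time `t`, so one `η`, and hence one `M`,
  -- serves all times.
  obtain ⟨η, hη⟩ : ∃ η, η = Δ / 8 := ⟨_, rfl⟩
  have hη0 : 0 < η := by linarith
  obtain ⟨ME, hME0, hME⟩ := hz.exists_divLE (ℓ := η / 8) (by linarith)
  obtain ⟨MF, hMF0, hMF⟩ := hy.exists_divLE (ℓ := η / 8) (by linarith)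
  set M := max ME MF with hM
  have hM0 : 0 ≤ M := hME0.trans (le_max_left _ _)
  -- `k` is the product `ε * η`, chosen after `M` so that the total loss up to time `t` is at most
  -- `Δ / 2`.
  obtain ⟨k, hk0, hk1, hkM⟩ : ∃ k : ℝ, 0 < k ∧ k ≤ 1 ∧ 2 * (k * M) * t ≤ Δ / 2 := by
    have hp : 0 < Δ + 4 * M * t := by positivity
    refine ⟨Δ / (Δ + 4 * M * t), by positivity, ?_, ?_⟩
    · rw [div_le_one hp]
      have : 0 ≤ 4 * M * t := by positivity
      linarith
    · have h1 : 2 * (Δ / (Δ + 4 * M * t) * M) * t = 2 * Δ * M * t / (Δ + 4 * M * t) := by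
        field_simp
      rw [h1, div_le_iff₀ hp]
      nlinarith [sq_nonneg Δ]
  set ε := k / η with hε
  have hε0 : 0 < ε := by positivity
  have hεη : ε * η = k := by rw [hε]; field_simp
  set m := 2 * (k * M) with hm
  have hm0 : 0 ≤ m := by positivity
  obtain ⟨δ, hδ0, hδ1, hδη, hδε⟩ : ∃ δ : ℝ, 0 < δ ∧ 2 * δ ≤ 1 ∧ 24 * δ ≤ η ∧
      32 * δ ≤ ε * η ^ 2 := by
    refine ⟨min (1 / 2) (min (η / 24) (ε * η ^ 2 / 32)), by positivity, ?_, ?_, ?_⟩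
    · linarith [min_le_left (1 / 2) (min (η / 24) (ε * η ^ 2 / 32))]
    · linarith [(min_le_right (1 / 2) (min (η / 24) (ε * η ^ 2 / 32))).trans (min_le_left _ _)]
    · linarith [(min_le_right (1 / 2) (min (η / 24) (ε * η ^ 2 / 32))).trans (min_le_right _ _)]
  have key : ∀ s, 0 ≤ s → s ≤ t → ∀ x ∈ slice E s, ∀ x' ∈ slice F s, Δ - m * s ≤ dist x x' := by
    refine real_induction_Ici ?_ (fun s hs hlt hst => ?_) (fun s hs hP => ?_)
    · intro _ x hx x' hx'
      simpa using hd x (hE.init hx) x' (hF.init hx')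
    · obtain ⟨v, hv, hvs⟩ := exists_seq_left (a := 0) (t := s) (Q := fun _ => True)
        (fun b _ hb => ⟨(b + s) / 2, by linarith, by linarith, trivial⟩) hs
      refine le_dist_of_tendsto_left hE hF hs (fun n => ⟨(hv n).1.le, (hv n).2.1⟩) hvs
        fun n x hx x' hx' => ?_
      have h1 := hlt (v n) (hv n).1.le (hv n).2.1 (by linarith [(hv n).2.1]) x hx x' hx'
      have h2 := mul_le_mul_of_nonneg_left (hv n).2.1.le hm0
      linarith
    · rcases le_or_gt t s with hts | hts
      · exact ⟨1, one_pos, fun u hu hut => absurd hu.1 (by linarith)⟩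
      rcases (slice E s).eq_empty_or_nonempty with he | hEne
      · refine ⟨1, one_pos, fun u hu _ x hx => ?_⟩
        rw [hE.slice_eq_empty_of_le hs he u hu.1.le] at hx
        exact hx.elim
      rcases (slice F s).eq_empty_or_nonempty with he | hFne
      · refine ⟨1, one_pos, fun u hu _ x _ x' hx' => ?_⟩
        rw [hF.slice_eq_empty_of_le hs he u hu.1.le] at hx'
        exact hx'.elim
      -- The slice may still be nonempty at the extinction time itself, but all later ones are
      -- empty.
      rcases le_or_gt (extinctionTime E) s with hTE | hTE
      · refine ⟨1, one_pos, fun u hu _ x hx => ?_⟩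
        rw [slice_eq_empty_of_extinctionTime_lt
          (hTE.trans_lt (EReal.coe_lt_coe_iff.2 hu.1))] at hx
        exact hx.elim
      rcases le_or_gt (extinctionTime F) s with hTF | hTF
      · refine ⟨1, one_pos, fun u hu _ x _ x' hx' => ?_⟩
        rw [slice_eq_empty_of_extinctionTime_lt
          (hTF.trans_lt (EReal.coe_lt_coe_iff.2 hu.1))] at hx'
        exact hx'.elim
      have hms : m * s ≤ Δ / 2 := (mul_le_mul_of_nonneg_left hts.le hm0).trans hkM
      obtain ⟨τ, hτ, h⟩ := exists_forall_le_dist hN hr hE hF hz hy hη0 hε0.le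
        (hεη.le.trans hk1) hM0 (hME.mono (le_max_left _ _)) (hMF.mono (le_max_right _ _))
        (m := m) (by rw [hεη]) hδ0 hδ1 hδη hδε hs (D := Δ - m * s) (by linarith)
        (hP hts.le) hTE hTF hEne hFne
      refine ⟨τ, hτ, fun u hu _ x hx x' hx' => ?_⟩
      have := h u hu x hx x' hx'
      linarith
  intro hx'
  have := key t ht le_rfl x hx x hx'
  rw [dist_self] at this
  linarith

end Comparison

end MinkowskiFlow

/-! ### The comparison principle for level set solutions. -/

theorem theorem3p12 (N : ℕ) (hN : 1 ≤ N) (r : ℝ) (hr : 0 < r)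
    (u₀ v₀ : MinkowskiFlow.Space N → ℝ)
    (hu₀ : UniformContinuous u₀) (hv₀ : UniformContinuous v₀)
    (hu₀_bdry : ∀ c : ℝ, IsCompact (frontier {x | u₀ x ≤ c}))
    (hv₀_bdry : ∀ c : ℝ, IsCompact (frontier {x | v₀ x ≤ c}))
    (u v : MinkowskiFlow.Space N × ℝ → ℝ)
    (hu : MinkowskiFlow.IsLevelSetSubsolution r u₀ u)
    (hv : MinkowskiFlow.IsLevelSetSupersolution r v₀ v)
    (hle : ∀ x, u₀ x ≤ v₀ x) :
    ∀ (x : MinkowskiFlow.Space N) (t : ℝ), 0 ≤ t → u (x, t) ≤ v (x, t) := by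
  intro x t ht
  by_contra! hlt
  -- Good levels are chosen on either side of the mean value: `v (x, t) < a < -b < u (x, t)`.
  obtain ⟨a, ha1, ha2, hE⟩ := MinkowskiFlow.exists_Ioo_of_ae
    (a := v (x, t)) (b := (u (x, t) + v (x, t)) / 2) (by linarith)
    (hv.superflow.mono fun c hc _ => hc)
  obtain ⟨b, hb1, hb2, hF⟩ := MinkowskiFlow.exists_Ioo_of_ae
    (a := -u (x, t)) (b := -((u (x, t) + v (x, t)) / 2)) (by linarith)
    (hu.superflow.mono fun c hc _ => hc)
  -- On the first initial set `u₀ ≤ v₀ ≤ a`, on the second `u₀ ≥ -b`; a gap of `-b - a` in the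
  -- values of `u₀` forces a distance of at least `Δ`.
  obtain ⟨Δ, hΔ, hcont⟩ := Metric.uniformContinuous_iff.1 hu₀ (-b - a) (by linarith)
  refine hE.disjoint hN hr hF hΔ (fun p hp q hq => ?_) ht (x := x) ⟨ht, ha1.le⟩ ⟨ht, hb1.le⟩
  by_contra! hpq
  have h1 := hcont hpq
  have h2 : v₀ p ≤ a := hp
  have h3 : -u₀ q ≤ b := hq
  have h4 := hle p
  rw [Real.dist_eq, abs_lt] at h1
  linarith [h1.1]
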